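/- Let $q$ be an indeterminate. Write $[m]_q=[m]=1+q+\cdots+q^{m-1}$, $(a;q)_k=(1-a)(1-aq)\cdots(1-aq^{k-1})$, and let $\Phi_m(q)$ be the $m$-th cyclotomic polynomial. For rational functions $A(q),B(q)$ and a polynomial $P(q)\in\mathbb{Z}[q]$, $A(q)\equiv B(q)\pmod{P(q)}$ means that $P(q)$ divides, in $\mathbb{Z}[q]$, the numerator of $A(q)-B(q)$ written in lowest terms over $\mathbb{Z}[q]$. Let $n>1$ be an odd integer and let $r\geqslant 1$ be an integer. Then, modulo $[n^r]\prod_{j=1}^r\Phi_{n^j}(q)^2$, $$\sum_{k=0}^{(n^r-1)/2} q^{k^2}[6k+1]\frac{(q;q^2)_k^2 (q^2;q^4)_k}{(q^4;q^4)_k^3} \equiv (-q)^{(1-n)/2}[n]\sum_{k=0}^{(n^{r-1}-1)/2} q^{nk^2}[6k+1]_{q^n}\frac{(q^n;q^{2n})_k^2 (q^{2n};q^{4n})_k}{(q^{4n};q^{4n})_k^3}$$ and $$\sum_{k=0}^{n^r-1} q^{k^2}[6k+1]\frac{(q;q^2)_k^2 (q^2;q^4)_k}{(q^4;q^4)_k^3}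 \equiv (-q)^{(1-n)/2}[n]\sum_{k=0}^{n^{r-1}-1} q^{nk^2}[6k+1]_{q^n}\frac{(q^n;q^{2n})_k^2 (q^{2n};q^{4n})_k}{(q^{4n};q^{4n})_k^3}.$$ -/

import Mathlib

open Polynomial

noncomputable section

namespace QDwork

/-- The `q`-integer `[m]_x = 1 + x + ⋯ + x^(m-1)`. -/
def qInt {K : Type*} [Field K] (m : ℕ) (x : K) : K :=
  ∑ i ∈ Finset.range m, x ^ i

/-- The `q`-shifted factorial `(a; x)_k = (1 - a)(1 - a x) ⋯ (1 - a x^(k-1))`. -/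
def qPochhammer {K : Type*} [Field K] (a x : K) (k : ℕ) : K :=
  ∏ i ∈ Finset.range k, (1 - a * x ^ i)

/-- The sum of `x^(k^2) [6k+1]_x (x; x^2)_k^2 (x^2; x^4)_k / (x^4; x^4)_k^3`
over `0 ≤ k ≤ M`. -/
def truncatedSum {K : Type*} [Field K] (x : K) (M : ℕ) : K :=
  ∑ k ∈ Finset.range (M + 1),
    x ^ (k ^ 2) * qInt (6 * k + 1) x *
      ((qPochhammer x (x ^ 2) k ^ 2 * qPochhammer (x ^ 2) (x ^ 4) k) /
        qPochhammer (x ^ 4) (x ^ 4) k ^ 3)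

/-- Congruence of rational functions in `q` modulo a polynomial `P` in `ℤ[q]`: when `A - B` is
written as a fraction in lowest terms over `ℤ[q]`, its numerator is divisible by `P` in `ℤ[q]`. -/
def CongrMod (P : ℤ[X]) (A B : RatFunc ℤ) : Prop :=
  ∃ N D : ℤ[X], D ≠ 0 ∧ IsRelPrime N D ∧
    A - B = algebraMap ℤ[X] (RatFunc ℤ) N / algebraMap ℤ[X] (RatFunc ℤ) D ∧ P ∣ N

/-- The modulus `[n^r] ∏_{j=1}^r Φ_{n^j}(q)^2`. -/
def modulus (n r : ℕ) : ℤ[X] :=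
  (∑ i ∈ Finset.range (n ^ r), (X : ℤ[X]) ^ i) *
    ∏ j ∈ Finset.Icc 1 r, (cyclotomic (n ^ j) ℤ) ^ 2

end QDwork

end

noncomputable section

namespace QDwork

section Fold
variable {A B : Type*} [CommRing A] [CommRing B]

/-- The sum `∑_{k ≤ M} t k / ∏_{i < k} δ i`, cleared of the denominator `∏_{i < M} δ i`. -/
def foldSum (t δ : ℕ → A) : ℕ → A
  | 0 => t 0
  | M + 1 => foldSum t δ M * δ M + t (M + 1)

/-- The summand `e k * v k * ∏_{i < k} ν i`. -/
def foldTerm (e v ν : ℕ → A) (k : ℕ) : A :=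
  e k * v k * ∏ i ∈ Finset.range k, ν i

theorem map_foldSum (f : A →+* B) (t δ : ℕ → A) (M : ℕ) :
    f (foldSum t δ M) = foldSum (fun k => f (t k)) (fun k => f (δ k)) M := by
  induction M with
  | zero => rfl
  | succ M ih => simp [foldSum, ih]

theorem foldSum_one (t : ℕ → A) (M : ℕ) :
    foldSum t (fun _ => 1) M = ∑ k ∈ Finset.range (M + 1), t k := by
  induction M with
  | zero => simp [foldSum]
  | succ M ih => rw [foldSum, ih, Finset.sum_range_succ _ (M + 1), mul_one]

theorem foldSum_eq_prod (t δ : ℕ → A) (M : ℕ) (h : ∀ k, 0 < k → t k = 0) :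
    foldSum t δ M = t 0 * ∏ i ∈ Finset.range M, δ i := by
  induction M with
  | zero => simp [foldSum]
  | succ M ih => rw [foldSum, ih, h _ M.succ_pos, Finset.prod_range_succ]; ring

/-- Rescaling the summands and the denominators compatibly. -/
theorem foldSum_mul_prod (t δ t' δ' c : ℕ → A) (M : ℕ)
    (ht : ∀ k ≤ M, t' k = t k * ∏ i ∈ Finset.range k, c i) (hδ : ∀ k < M, δ' k = δ k * c k) :
    foldSum t' δ' M = foldSum t δ M * ∏ i ∈ Finset.range M, c i := by
  induction M with
  | zero => simpa [foldSum] using ht 0 le_rfl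
  | succ M ih =>
    rw [foldSum, foldSum, ih (fun k hk => ht k (by omega)) (fun k hk => hδ k (by omega)),
      ht _ le_rfl, hδ _ (by omega), Finset.prod_range_succ]
    ring

/-- A sequence `v` whose ratio of consecutive terms is `α k / β k`, with `α`, `β` periodic modulo
`d`, is multiplicative with respect to division by `d`. -/
theorem mul_add_eq_of_periodic {v α β : ℕ → A} {d : ℕ} (h0 : v 0 = 1)
    (hv : ∀ k, v (k + 1) * β k = v k * α k) (hα : ∀ k, α (k + d) = α k)
    (hβ : ∀ k, β (k + d) = β k) (hu : ∀ k, ¬ d ∣ k + 1 → IsUnit (β k)) (l j : ℕ) (hj : j < d) :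
    v (l * d + j) = v (l * d) * v j := by
  have hp : ∀ {f : ℕ → A}, (∀ k, f (k + d) = f k) → ∀ l k, f (l * d + k) = f k := by
    intro f hf l k
    induction l with
    | zero => simp
    | succ l ih => rw [← ih, ← hf (l * d + k)]; congr 1; ring
  induction j with
  | zero => simp [h0]
  | succ j ih =>
    have hu' := hu j fun h => by have := Nat.le_of_dvd (by omega) h; omega
    apply hu'.mul_right_cancel
    have := hv (l * d + j)
    rw [hp hα, hp hβ, ih (by omega)] at this
    rw [← add_assoc, this, mul_assoc, mul_assoc, hv]

theorem eq_zero_of_periodic {v α β : ℕ → A} {d h : ℕ}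
    (hv : ∀ k, v (k + 1) * β k = v k * α k) (hu : ∀ k, ¬ d ∣ k + 1 → IsUnit (β k))
    (hα : α h = 0) (j : ℕ) (hj : j < d) (hhj : h < j) : v j = 0 := by
  induction j, hhj using Nat.le_induction with
  | base =>
    have hu' := hu h fun H => by have := Nat.le_of_dvd (by omega) H; omega
    apply hu'.mul_right_cancel
    rw [hv, hα]; simp
  | succ j hj' ih =>
    have hu' := hu j fun H => by have := Nat.le_of_dvd (by omega) H; omega
    apply hu'.mul_right_cancel
    rw [hv, ih (by omega)]; simp

/-- If the first block of a periodic cleared sum vanishes, then so do all the later ones. -/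
theorem foldSum_block_eq_zero {e v ν δ : ℕ → A} {d h : ℕ} (hd : h < d)
    (he : ∀ k, e (k + d) = e k) (hν : ∀ k, ν (k + d) = ν k) (hδ : ∀ k, δ (k + d) = δ k)
    (h0 : v 0 = 1)
    (hv : ∀ l j, j < d → v (l * d + j) = v (l * d) * v j)
    (hz : ∀ j, j < d → h < j → v j = 0) (hP : foldSum (foldTerm e v ν) δ h = 0) (l : ℕ) :
    foldSum (foldTerm e v ν) δ (l * d + h) = 0 ∧
      foldSum (foldTerm e v ν) δ (l * d + (d - 1)) = 0 := by
  have hp : ∀ {f : ℕ → A}, (∀ k, f (k + d) = f k) → ∀ l k, f (l * d + k) = f k := by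
    intro f hf l k
    induction l with
    | zero => simp
    | succ l ih => rw [← ih, ← hf (l * d + k)]; congr 1; ring
  set P := foldSum (foldTerm e v ν) δ with hPdef
  have hν' : ∀ l j, ∏ i ∈ Finset.range (l * d + j), ν i =
      (∏ i ∈ Finset.range d, ν i) ^ l * ∏ i ∈ Finset.range j, ν i := by
    intro l j
    rw [Finset.prod_range_add]
    simp_rw [hp hν]
    congr 1
    induction l with
    | zero => simp
    | succ l ih =>
      rw [Nat.succ_mul, Finset.prod_range_add, ih, pow_succ]
      simp_rw [hp hν]
  have hlast : ∀ j, h ≤ j → j < d → P j = 0 := by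
    intro j hj
    induction j, hj using Nat.le_induction with
    | base => exact fun _ => hP
    | succ j hj ih =>
      intro hjd
      rw [hPdef, foldSum, ← hPdef, ih (by omega), foldTerm, hz _ hjd (by omega)]
      simp
  have key : ∀ l j, j < d → P (l * d + j) =
      v (l * d) * (∏ i ∈ Finset.range d, ν i) ^ l * P j := by
    have step : ∀ l, P (l * d) = v (l * d) * (∏ i ∈ Finset.range d, ν i) ^ l * P 0 →
        ∀ j, j < d → P (l * d + j) = v (l * d) * (∏ i ∈ Finset.range d, ν i) ^ l * P j := by
      intro l hl j
      induction j with
      | zero => exact fun _ => hl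
      | succ j ih =>
        intro hj
        rw [← add_assoc, hPdef, foldSum, foldSum, ← hPdef, ih (by omega), hp hδ, foldTerm,
          foldTerm, add_assoc, hv _ _ hj, hp he, hν']
        ring
    intro l
    induction l with
    | zero => apply step; simp [h0]
    | succ l ih =>
      apply step
      have h1 := ih (d - 1) (by omega)
      rw [hlast (d - 1) (by omega) (by omega), mul_zero] at h1
      have h2 : (l + 1) * d = l * d + (d - 1) + 1 := by
        rw [Nat.succ_mul]; omega
      have h3 : P ((l + 1) * d) = foldTerm e v ν ((l + 1) * d) := by
        conv_lhs => rw [h2, hPdef, foldSum, ← hPdef, h1, zero_mul, zero_add, ← h2]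
      have h4 := hν' (l + 1) 0
      have h5 := hp he (l + 1) 0
      simp only [add_zero] at h4 h5
      rw [h3, foldTerm, h4, h5, hPdef, foldSum, foldTerm, h0]
      simp
      ring
  rw [key l h hd, key l (d - 1) (by omega), hP, hlast (d - 1) (by omega) (by omega)]
  simp

end Fold

section Param
variable {A B : Type*} [CommRing A] [CommRing B]

/-- The factor `(1 - a q^(2i+1)) (a - q^(2i+1))` of the numerator. -/
def paramNum (q a : A) (i : ℕ) : A := (1 - a * q ^ (2 * i + 1)) * (a - q ^ (2 * i + 1))

/-- The factor `(1 - a q^(4i+4)) (a - q^(4i+4))` of the denominator. -/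
def paramDen (q a : A) (i : ℕ) : A := (1 - a * q ^ (4 * i + 4)) * (a - q ^ (4 * i + 4))

/-- The factor `q^(k^2) [6k+1]`. -/
def weight (q : A) (k : ℕ) : A := q ^ (k ^ 2) * ∑ i ∈ Finset.range (6 * k + 1), q ^ i

/-- The sequence `v k` satisfies the recurrence of `(q^2; q^4)_k / (q^4; q^4)_k`. -/
structure IsRatioSeq (q : A) (v : ℕ → A) : Prop where
  zero : v 0 = 1
  succ : ∀ k, v (k + 1) * (1 - q ^ (4 * k + 4)) = v k * (1 - q ^ (4 * k + 2))

/-- The truncated sum with a parameter `a`, cleared of the denominators depending on `a`. -/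
def paramSum (q a : A) (v : ℕ → A) (M : ℕ) : A :=
  foldSum (foldTerm (weight q) v (paramNum q a)) (paramDen q a) M

theorem paramSum_succ (q a : A) (v : ℕ → A) (M : ℕ) :
    paramSum q a v (M + 1) = paramSum q a v M * paramDen q a M +
      foldTerm (weight q) v (paramNum q a) (M + 1) := rfl

theorem map_weight (f : A →+* B) (q : A) (k : ℕ) : f (weight q k) = weight (f q) k := by
  simp [weight]

theorem map_paramSum (f : A →+* B) (q a : A) (v : ℕ → A) (M : ℕ) :
    f (paramSum q a v M) = paramSum (f q) (f a) (fun k => f (v k)) M := by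
  rw [paramSum, map_foldSum, paramSum]
  congr 1
  · ext k; simp [foldTerm, paramNum, map_weight]
  · ext k; simp [paramDen]

theorem IsRatioSeq.map {q : A} {v : ℕ → A} (h : IsRatioSeq q v) (f : A →+* B) :
    IsRatioSeq (f q) (fun k => f (v k)) :=
  ⟨by simp [h.zero], fun k => by simpa using congrArg f (h.succ k)⟩

theorem one_sub_mul_weight (q : A) (k : ℕ) :
    (1 - q) * weight q k = q ^ (k ^ 2) * (1 - q ^ (6 * k + 1)) := by
  rw [weight, mul_left_comm, mul_neg_geom_sum]

theorem pow_mul_prod_paramNum (q a : A) (M : ℕ) :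
    q ^ (M + 1) * ∏ i ∈ Finset.range (M + 1), paramNum q a i =
      -((∏ i ∈ Finset.range M, (1 - a * q ^ (2 * i + 3))) *
        ∏ i ∈ Finset.range (M + 2), (a * q - q ^ (2 * i))) := by
  induction M with
  | zero => simp [paramNum, Finset.prod_range_succ]; ring
  | succ M ih =>
    rw [Finset.prod_range_succ (fun i => paramNum q a i) (M + 1),
      Finset.prod_range_succ (fun i => 1 - a * q ^ (2 * i + 3)) M,
      Finset.prod_range_succ (fun i => a * q - q ^ (2 * i)) (M + 2), paramNum]
    linear_combination (q * ((1 - a * q ^ (2 * (M + 1) + 1)) * (a - q ^ (2 * (M + 1) + 1)))) * ih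

theorem prod_paramNum_mul_pow_four (q a : A) (M : ℕ) :
    ∏ i ∈ Finset.range (M + 1), paramNum q (a * q ^ 4) i =
      -(q ^ (3 * M + 1) * (∏ i ∈ Finset.range (M + 2), (1 - a * q ^ (2 * i + 3))) *
        ∏ i ∈ Finset.range M, (a * q - q ^ (2 * i))) := by
  induction M with
  | zero => simp [paramNum, Finset.prod_range_succ]; ring
  | succ M ih =>
    rw [Finset.prod_range_succ (fun i => paramNum q (a * q ^ 4) i) (M + 1),
      Finset.prod_range_succ (fun i => 1 - a * q ^ (2 * i + 3)) (M + 2),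
      Finset.prod_range_succ (fun i => a * q - q ^ (2 * i)) M, paramNum]
    linear_combination ((1 - a * q ^ 4 * q ^ (2 * (M + 1) + 1)) *
      (a * q ^ 4 - q ^ (2 * (M + 1) + 1))) * ih

/-- A contiguous relation between the parameters `a` and `a q^4`. -/
theorem paramSum_contiguous {q : A} (hq : IsUnit q) (a : A) {v : ℕ → A} (hv : IsRatioSeq q v)
    (M : ℕ) :
    (1 - q) * (q ^ 2 * paramSum q (a * q ^ 4) v M * (a - q ^ (4 * M)) +
        q ^ (4 * M) * (1 - a * q ^ (4 * M + 4)) * paramSum q a v M) =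
      q ^ (M ^ 2 + 5 * M) * (1 - q ^ (2 * M + 1)) * (1 - q ^ (4 * M + 2)) * v M *
        (1 + a * q ^ 2) * (∏ i ∈ Finset.range M, (1 - a * q ^ (2 * i + 3))) *
        ∏ i ∈ Finset.range M, (a * q - q ^ (2 * i)) := by
  induction M with
  | zero => simp [paramSum, foldSum, foldTerm, weight, hv.zero]; ring
  | succ M ih =>
    have hN1 := pow_mul_prod_paramNum q a M
    have hN2 := prod_paramNum_mul_pow_four q a M
    have hw := one_sub_mul_weight q (M + 1)
    have hvM := hv.succ M
    rw [paramSum_succ, paramSum_succ, foldTerm, foldTerm, paramDen, paramDen]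
    rw [Finset.prod_range_succ (fun i => a * q - q ^ (2 * i)) (M + 1),
      Finset.prod_range_succ (fun i => a * q - q ^ (2 * i)) M] at hN1
    rw [Finset.prod_range_succ (fun i => 1 - a * q ^ (2 * i + 3)) (M + 1),
      Finset.prod_range_succ (fun i => 1 - a * q ^ (2 * i + 3)) M] at hN2
    rw [Finset.prod_range_succ (fun i => 1 - a * q ^ (2 * i + 3)) M,
      Finset.prod_range_succ (fun i => a * q - q ^ (2 * i)) M]
    generalize (∏ i ∈ Finset.range M, (1 - a * q ^ (2 * i + 3))) = α at *
    generalize (∏ i ∈ Finset.range M, (a * q - q ^ (2 * i))) = β at *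
    generalize ∏ i ∈ Finset.range (M + 1), paramNum q a i = N at *
    generalize ∏ i ∈ Finset.range (M + 1), paramNum q (a * q ^ 4) i = N' at *
    generalize paramSum q a v M = P at *
    generalize paramSum q (a * q ^ 4) v M = P' at *
    generalize weight q (M + 1) = w at *
    generalize v (M + 1) = v' at *
    generalize v M = v₀ at *
    apply (hq.pow (M + 1)).mul_left_cancel
    subst hN2
    linear_combination (q ^ (M + 1) * q ^ 4 * (a - q ^ (4 * M + 4)) * (1 - a * q ^ (4 * M + 8))) * ih
      + q ^ (M + 1) * q ^ 4 * (a - q ^ (4 * M + 4)) * (1 - a * q ^ (4 * M + 8)) * q ^ (M ^ 2 + 5 * M)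
        * (1 - q ^ (2 * M + 1)) * (1 + a * q ^ 2) * α * β * (-hvM)
      + q ^ (4 * M + 4) * (1 - a * q ^ (4 * M + 8)) * v' * (1 - q) * w * hN1
      + v' * α * β * (-q ^ (4 * M + 4) * (1 - a * q ^ (4 * M + 8)) * (a * q - q ^ (2 * M)) *
          (a * q - q ^ (2 * M + 2))
        - q ^ (M + 1) * q ^ 2 * (a - q ^ (4 * M + 4)) * q ^ (3 * M + 1) *
          (1 - a * q ^ (2 * M + 3)) * (1 - a * q ^ (2 * M + 5))) * hw

end Param

section Evaluation
variable {A : Type*} [CommRing A]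

theorem prod_paramDen_mul_pow_four (q a : A) (M : ℕ) :
    (∏ i ∈ Finset.range M, paramDen q (a * q ^ 4) i) * (1 - a * q ^ 4) * (a - q ^ (4 * M)) =
      q ^ (4 * M) * (1 - a * q ^ (4 * M + 4)) * (a - 1) *
        ∏ i ∈ Finset.range M, paramDen q a i := by
  induction M with
  | zero => simp
  | succ M ih =>
    rw [Finset.prod_range_succ, Finset.prod_range_succ, paramDen, paramDen]
    linear_combination (q ^ 4 * (1 - a * q ^ (4 * M + 8)) * (a - q ^ (4 * M + 4))) * ih

theorem paramSum_eq_prod {q a : A} {v : ℕ → A} (hv : IsRatioSeq q v) (h : paramNum q a 0 = 0)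
    (M : ℕ) : paramSum q a v M = ∏ i ∈ Finset.range M, paramDen q a i := by
  rw [paramSum, foldSum_eq_prod]
  · simp [foldTerm, weight, hv.zero]
  · intro k hk
    rw [foldTerm, Finset.prod_eq_zero (Finset.mem_range.2 hk) h, mul_zero]

/-- Evaluation of the cleared sum at `a = q^(2j+1)`. -/
theorem paramSum_odd_pow {F : Type*} [Field F] {q : F}
    (hq : Function.Injective fun i : ℕ => q ^ i) {v : ℕ → F} (hv : IsRatioSeq q v) (M : ℕ) :
    ∀ j ≤ M, (1 - q) * q ^ j * paramSum q (q ^ (2 * j + 1)) v M =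
      (-1) ^ j * (1 - q ^ (2 * j + 1)) *
        ∏ i ∈ Finset.range M, paramDen q (q ^ (2 * j + 1)) i := by
  have hne : ∀ {m n : ℕ}, m ≠ n → q ^ m - q ^ n ≠ 0 := fun h => sub_ne_zero.2 (hq.ne h)
  have hq0 : q ≠ 0 := by
    rintro rfl
    have := hq.ne (show (1 : ℕ) ≠ 2 by norm_num)
    simp at this
  have h1 : 1 - q ≠ 0 := by simpa using hne (show 0 ≠ 1 by norm_num)
  intro j
  induction j using Nat.twoStepInduction with
  | zero =>
    intro _
    rw [paramSum_eq_prod hv]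
    · simp
    · simp [paramNum]
  | one =>
    intro hM
    have hc := paramSum_contiguous hq0.isUnit q⁻¹ hv M
    have hz : ∏ i ∈ Finset.range M, (q⁻¹ * q - q ^ (2 * i)) = 0 :=
      Finset.prod_eq_zero (Finset.mem_range.2 hM) (by simp [hq0])
    have hD := prod_paramDen_mul_pow_four q q⁻¹ M
    have ha : q⁻¹ * q ^ 4 = q ^ (2 * 1 + 1) := by field_simp
    rw [hz, mul_zero, paramSum_eq_prod (a := q⁻¹) hv (by simp [paramNum, hq0]), ha] at hc
    rw [ha] at hD
    have hx : q⁻¹ - q ^ (4 * M) ≠ 0 := by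
      intro h
      apply hne (show 0 ≠ 4 * M + 1 by omega)
      have := congrArg (q * ·) h
      simp only [mul_sub, mul_inv_cancel₀ hq0] at this
      rw [pow_succ]; linear_combination this
    have hc' := (mul_eq_zero.1 hc).resolve_left h1
    apply mul_right_cancel₀ hx
    have e1 : q⁻¹ * q = 1 := inv_mul_cancel₀ hq0
    apply mul_left_cancel₀ hq0
    linear_combination (1 - q) * hc' + q * hD +
      q ^ (4 * M) * (1 - q⁻¹ * q ^ (4 * M + 4)) * (∏ i ∈ Finset.range M, paramDen q q⁻¹ i) * e1
  | more j ih _ =>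
    intro hM
    have ih := ih (by omega)
    have hc := paramSum_contiguous hq0.isUnit (q ^ (2 * j + 1)) hv M
    have hz : ∏ i ∈ Finset.range M, (q ^ (2 * j + 1) * q - q ^ (2 * i)) = 0 :=
      Finset.prod_eq_zero (Finset.mem_range.2 (show j + 1 < M by omega)) (by ring)
    have hD := prod_paramDen_mul_pow_four q (q ^ (2 * j + 1)) M
    have ha : q ^ (2 * j + 1) * q ^ 4 = q ^ (2 * (j + 2) + 1) := by ring
    rw [hz, mul_zero, ha] at hc
    rw [ha] at hD
    have hc' := (mul_eq_zero.1 hc).resolve_left h1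
    apply mul_right_cancel₀ (hne (show 2 * j + 1 ≠ 4 * M by omega))
    linear_combination (1 - q) * q ^ j * hc' - (-1) ^ j * hD -
      q ^ (4 * M) * (1 - q ^ (2 * j + 1) * q ^ (4 * M + 4)) * ih

theorem paramDen_natDegree_le (q : A) (i : ℕ) : (paramDen (C q) X i).natDegree ≤ 2 := by
  rw [paramDen, ← C_pow]; compute_degree

theorem paramNum_natDegree_le (q : A) (i : ℕ) : (paramNum (C q) X i).natDegree ≤ 2 := by
  rw [paramNum, ← C_pow]; compute_degree

theorem paramSum_natDegree_le (q : A) (v : ℕ → A) (M : ℕ) :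
    (paramSum (C q) X (fun k => C (v k)) M).natDegree ≤ 2 * M := by
  have ht : ∀ k, (foldTerm (weight (C q)) (fun k => C (v k)) (paramNum (C q) X) k).natDegree
      ≤ 2 * k := by
    intro k
    rw [foldTerm, ← map_weight, ← C_mul]
    refine (natDegree_C_mul_le _ _).trans ((natDegree_prod_le _ _).trans ?_)
    refine (Finset.sum_le_card_nsmul _ _ 2 fun i _ => paramNum_natDegree_le q i).trans ?_
    simp [mul_comm]
  induction M with
  | zero => exact ht 0
  | succ M ih =>
    rw [paramSum_succ]
    refine natDegree_add_le_of_degree_le ?_ (ht _)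
    exact natDegree_mul_le.trans (by have := paramDen_natDegree_le q M; omega)

/-- For `q` a root of unity of odd order `2h+1 > 1`, the cleared sum up to `h` vanishes
identically in the parameter as soon as it vanishes at `1`. -/
theorem paramSum_X_eq_zero {q : A} {h : ℕ} (hh : 0 < h) (hq : q ^ (2 * h + 1) = 1)
    (hu : ∀ i, ¬ 2 * h + 1 ∣ i → IsUnit (1 - q ^ i)) {v : ℕ → A} (hv : IsRatioSeq q v)
    (h1 : paramSum q 1 v h = 0) : paramSum (C q) X (fun k => C (v k)) h = 0 := by
  have hqu : IsUnit q := IsUnit.of_pow_eq_one hq (by omega)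
  have hc := paramSum_contiguous (hqu.map C) X (hv.map C) h
  set P := paramSum (C q) X (fun k => C (v k)) h with hP
  have hcomp : paramSum (C q) (X * C q ^ 4) (fun k => C (v k)) h = P.comp (C (q ^ 4) * X) := by
    have := map_paramSum (compRingHom (C (q ^ 4) * X)) (C q) X (fun k => C (v k)) h
    simp only [coe_compRingHom_apply, X_comp, C_comp] at this
    rw [hP, this, C_pow, mul_comm]
  have e0 : (C q) ^ (4 * h + 2) = 1 := by
    rw [← C_pow, show 4 * h + 2 = (2 * h + 1) * 2 by ring, pow_mul, hq]; simp
  have e1 : (C q) ^ (4 * h) * (C q) ^ 2 = 1 := by rw [← pow_add, e0]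
  have e2 : (C q) ^ (4 * h + 4) = C q ^ 2 := by
    rw [show 4 * h + 4 = (4 * h + 2) + 2 by ring, pow_add, e0, one_mul]
  have hu1 : IsUnit (1 - C q) := by
    have := (hu 1 (by rw [Nat.dvd_one]; omega)).map C
    simpa using this
  rw [e0, sub_self, mul_zero, zero_mul, zero_mul, zero_mul, zero_mul, hu1.mul_right_eq_zero, e2,
    hcomp] at hc
  have hfun : P.comp (C (q ^ 4) * X) = C (q ^ (4 * h)) * P := by
    apply (monic_X_sub_C (q ^ (4 * h))).isRegular.right
    apply ((hqu.map C).pow 2).mul_left_cancel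
    simp only [C_pow] at hc ⊢
    linear_combination hc + C q ^ (4 * h) * P * e1
  have hcoeff : ∀ j, j ≠ h → P.coeff j = 0 := by
    intro j hj
    by_cases hjd : 2 * h < j
    · exact coeff_eq_zero_of_natDegree_lt ((paramSum_natDegree_le q v h).trans_lt hjd)
    have := congrArg (coeff · j) hfun
    simp only [comp_C_mul_X_coeff, coeff_C_mul] at this
    have hz : P.coeff j * (q ^ (4 * j) - q ^ (4 * h)) = 0 := by
      rw [mul_sub, pow_mul, this]; ring
    have hcop : Nat.Coprime (2 * h + 1) 4 := by
      rw [show 4 = 2 ^ 2 by norm_num]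
      exact Nat.Coprime.pow_right 2 (by simp)
    have key : ∀ m, 0 < m → m ≤ h → IsUnit (1 - q ^ (4 * m)) := by
      intro m hm hmh
      refine hu _ fun hdvd => ?_
      have := Nat.le_of_dvd hm (hcop.dvd_of_dvd_mul_left hdvd)
      omega
    have hunit : IsUnit (q ^ (4 * j) - q ^ (4 * h)) := by
      rcases lt_or_gt_of_ne hj with hlt | hgt
      · obtain ⟨m, rfl⟩ := Nat.exists_eq_add_of_lt hlt
        have := (hqu.pow (4 * j)).mul (key (m + 1) (by omega) (by omega))
        convert this using 1; ring
      · obtain ⟨m, rfl⟩ := Nat.exists_eq_add_of_lt hgt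
        have := (hqu.pow (4 * h)).mul (key (m + 1) (by omega) (by omega))
        convert this.neg using 1; ring
    exact hunit.mul_left_eq_zero.1 hz
  have hPe : P = C (P.coeff h) * X ^ h := by
    ext j
    rw [coeff_C_mul, coeff_X_pow]
    by_cases hj : j = h
    · simp [hj]
    · simp [hj, hcoeff j hj]
  have he : P.eval 1 = 0 := by
    have := map_paramSum (evalRingHom (1 : A)) (C q) X (fun k => C (v k)) h
    simp only [coe_evalRingHom, eval_C, eval_X] at this
    rw [hP, this, h1]
  rw [hPe] at he
  rw [hPe]
  simp at he
  simp [he]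

end Evaluation

/-- `q` behaves like a primitive `d`-th root of unity modulo `1 - q^d`, which is nonzero and
divides each `1 - q^(d j)`, `j > 0`, exactly once. -/
structure IsNearRoot {O : Type*} [CommRing O] (q : O) (d : ℕ) : Prop where
  isUnit : IsUnit q
  isUnit_one_sub : ∀ i, ¬ d ∣ i → IsUnit (1 - q ^ i)
  isUnit_geom : ∀ j, 0 < j → IsUnit (∑ i ∈ Finset.range j, (q ^ d) ^ i)
  ne_zero : 1 - q ^ d ≠ 0

namespace IsNearRoot
variable {O : Type*} [CommRing O] {q : O} {d : ℕ}

theorem pos (h : IsNearRoot q d) : 0 < d := by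
  rcases Nat.eq_zero_or_pos d with rfl | hd
  · exact absurd (by simp) h.ne_zero
  · exact hd

theorem one_sub_pow_mul (q : O) (d j : ℕ) :
    1 - q ^ (d * j) = (1 - q ^ d) * ∑ i ∈ Finset.range j, (q ^ d) ^ i := by
  rw [mul_neg_geom_sum, pow_mul]

theorem one_sub_dvd_pow (q : O) (d n : ℕ) :
    1 - q ^ d ∣ 1 - (q ^ n) ^ (d / d.gcd n) := by
  obtain ⟨c, hc⟩ : d ∣ n * (d / d.gcd n) := by
    rw [← Nat.mul_div_assoc _ (Nat.gcd_dvd_left d n), mul_comm, Nat.mul_div_assoc _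
      (Nat.gcd_dvd_right d n)]
    exact Dvd.intro _ rfl
  rw [← pow_mul, hc, one_sub_pow_mul]
  exact dvd_mul_right _ _

theorem prod_one_sub_pow (h : IsNearRoot q d) {ι : Type*} (s : Finset ι) (f : ι → ℕ)
    (hf : ∀ i ∈ s, 0 < f i) : ∃ u : O, IsUnit u ∧
      ∏ i ∈ s, (1 - q ^ f i) = u * (1 - q ^ d) ^ (s.filter fun i => d ∣ f i).card := by
  classical
  induction s using Finset.induction_on with
  | empty => exact ⟨1, isUnit_one, by simp⟩
  | insert a s ha ih =>
    obtain ⟨u, hu, he⟩ := ih fun i hi => hf i (Finset.mem_insert_of_mem hi)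
    rw [Finset.prod_insert ha, he, Finset.filter_insert]
    by_cases hd : d ∣ f a
    · obtain ⟨j, hj⟩ := hd
      have hpos := hf a (Finset.mem_insert_self _ _)
      refine ⟨_, hu.mul (h.isUnit_geom j (Nat.pos_of_mul_pos_left (hj ▸ hpos))), ?_⟩
      rw [if_pos ⟨j, hj⟩, Finset.card_insert_of_notMem (by simp [ha]), hj, one_sub_pow_mul]
      ring
    · refine ⟨_, (h.isUnit_one_sub _ hd).mul hu, ?_⟩
      rw [if_neg hd]
      ring

theorem card_filter_dvd_four_mul (hodd : Odd d) (k : ℕ) :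
    ((Finset.range k).filter fun i => d ∣ 4 * i + 4).card = k / d := by
  rw [← Nat.card_multiples k d]
  congr 1
  apply Finset.filter_congr
  intro i _
  have hcop : Nat.Coprime d 4 := by
    rw [show 4 = 2 ^ 2 by norm_num]
    exact Nat.Coprime.pow_right 2 hodd.coprime_two_right
  rw [show 4 * i + 4 = 4 * (i + 1) by ring]
  exact ⟨hcop.dvd_of_dvd_mul_left, fun h => h.mul_left _⟩

theorem le_card_filter_dvd_two_mul (hodd : Odd d) (k : ℕ) :
    k / d ≤ ((Finset.range k).filter fun i => d ∣ 2 * i + 1).card := by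
  obtain ⟨h, rfl⟩ := hodd
  rw [← Finset.card_range (k / (2 * h + 1))]
  refine Finset.card_le_card_of_injOn (fun t => t * (2 * h + 1) + h) ?_ ?_
  · intro t ht
    have ht' : t + 1 ≤ k / (2 * h + 1) := by simpa using ht
    have := (Nat.le_div_iff_mul_le (by omega)).1 ht'
    simp only [Finset.coe_filter, Finset.mem_range, Set.mem_ofPred_eq]
    refine ⟨by rw [Nat.succ_mul] at this; omega, 2 * t + 1, by ring⟩
  · intro t _ t' _ he
    simp only [add_left_inj] at he
    exact Nat.eq_of_mul_eq_mul_right (by omega) he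

/-- Products of the form `∏ (1 - q^(c i)) / (q^4; q^4)_k` lie in `O`. -/
theorem exists_ratio (h : IsNearRoot q d) (hodd : Odd d) (c : ℕ → ℕ) (hc : ∀ i, 0 < c i)
    (hcard : ∀ k, k / d ≤ ((Finset.range k).filter fun i => d ∣ c i).card) :
    ∃ v : ℕ → O, ∀ k, v k * ∏ i ∈ Finset.range k, (1 - q ^ (4 * i + 4)) =
      ∏ i ∈ Finset.range k, (1 - q ^ c i) := by
  have : ∀ k, ∃ x : O, x * ∏ i ∈ Finset.range k, (1 - q ^ (4 * i + 4)) =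
      ∏ i ∈ Finset.range k, (1 - q ^ c i) := by
    intro k
    obtain ⟨u, hu, he⟩ := h.prod_one_sub_pow (Finset.range k) (fun i => 4 * i + 4) (by simp)
    obtain ⟨u', -, he'⟩ := h.prod_one_sub_pow (Finset.range k) c (fun i _ => hc i)
    obtain ⟨r, hr⟩ := Nat.exists_eq_add_of_le (hcard k)
    obtain ⟨w, rfl⟩ := hu
    refine ⟨↑w⁻¹ * u' * (1 - q ^ d) ^ r, ?_⟩
    rw [he, he', card_filter_dvd_four_mul hodd, hr, pow_add]
    linear_combination (u' * (1 - q ^ d) ^ (k / d) * (1 - q ^ d) ^ r) * w.inv_mul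
  choose v hv using this
  exact ⟨v, hv⟩

theorem exists_ratio_four (h : IsNearRoot q d) (hodd : Odd d) :
    ∃ v : ℕ → O, ∀ k, v k * ∏ i ∈ Finset.range k, (1 - q ^ (4 * i + 4)) =
      ∏ i ∈ Finset.range k, (1 - q ^ (4 * i + 2)) := by
  refine h.exists_ratio hodd (fun i => 4 * i + 2) (by simp) fun k => ?_
  refine (le_card_filter_dvd_two_mul hodd k).trans (Finset.card_le_card ?_)
  intro i hi
  simp only [Finset.mem_filter] at hi ⊢
  exact ⟨hi.1, by rw [show 4 * i + 2 = 2 * (2 * i + 1) by ring]; exact hi.2.mul_left _⟩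

theorem exists_ratio_two (h : IsNearRoot q d) (hodd : Odd d) :
    ∃ v : ℕ → O, ∀ k, v k * ∏ i ∈ Finset.range k, (1 - q ^ (4 * i + 4)) =
      ∏ i ∈ Finset.range k, (1 - q ^ (2 * i + 1)) :=
  h.exists_ratio hodd (fun i => 2 * i + 1) (by simp) (le_card_filter_dvd_two_mul hodd)

variable [IsDomain O]

theorem one_sub_pow_ne_zero (h : IsNearRoot q d) {i : ℕ} (hi : 0 < i) : 1 - q ^ i ≠ 0 := by
  by_cases hd : d ∣ i
  · obtain ⟨j, rfl⟩ := hd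
    rw [one_sub_pow_mul]
    exact mul_ne_zero h.ne_zero (h.isUnit_geom j (Nat.pos_of_mul_pos_left hi)).ne_zero
  · exact (h.isUnit_one_sub i hd).ne_zero

theorem pow_injective (h : IsNearRoot q d) : Function.Injective fun i : ℕ => q ^ i := by
  have key : ∀ m n : ℕ, m < n → q ^ m ≠ q ^ n := by
    intro m n hmn he
    obtain ⟨k, rfl⟩ := Nat.exists_eq_add_of_lt hmn
    apply h.one_sub_pow_ne_zero (show 0 < k + 1 by omega)
    apply (h.isUnit.pow m).mul_left_cancel
    linear_combination he
  intro m n he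
  rcases lt_trichotomy m n with hl | hl | hl
  · exact absurd he (key _ _ hl)
  · exact hl
  · exact absurd he.symm (key _ _ hl)

theorem pow (h : IsNearRoot q d) {n : ℕ} (hn : 0 < n) : IsNearRoot (q ^ n) (d / d.gcd n) := by
  have hg : 0 < d.gcd n := Nat.gcd_pos_of_pos_right _ hn
  obtain ⟨c, hc⟩ : d ∣ n * (d / d.gcd n) := by
    rw [← Nat.mul_div_assoc _ (Nat.gcd_dvd_left d n), mul_comm, Nat.mul_div_assoc _
      (Nat.gcd_dvd_right d n)]
    exact Dvd.intro _ rfl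
  have hdpos := h.pos
  have hd' : 0 < d / d.gcd n := Nat.div_pos (Nat.le_of_dvd hdpos (Nat.gcd_dvd_left _ _)) hg
  have hcpos : 0 < c := by
    rcases Nat.eq_zero_or_pos c with rfl | h0
    · have := Nat.mul_pos hn hd'; omega
    · exact h0
  refine ⟨h.isUnit.pow n, fun i hi => ?_, fun j hj => ?_, ?_⟩
  · rw [← pow_mul]
    refine h.isUnit_one_sub _ fun hdvd => hi ?_
    have := Nat.Coprime.dvd_of_dvd_mul_left
      (Nat.coprime_div_gcd_div_gcd hg) (n := i) (k := d / d.gcd n) (m := n / d.gcd n) ?_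
    · exact this
    · rw [← Nat.mul_dvd_mul_iff_left hg, Nat.mul_div_cancel' (Nat.gcd_dvd_left d n), ← mul_assoc,
        Nat.mul_div_cancel' (Nat.gcd_dvd_right d n)]
      exact hdvd
  · rw [← pow_mul, hc]
    have e : (∑ i ∈ Finset.range c, (q ^ d) ^ i) * ∑ i ∈ Finset.range j, (q ^ (d * c)) ^ i =
        ∑ i ∈ Finset.range (c * j), (q ^ d) ^ i := by
      apply mul_left_cancel₀ h.ne_zero
      rw [← mul_assoc, ← one_sub_pow_mul, ← one_sub_pow_mul, ← one_sub_pow_mul, mul_assoc]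
    exact isUnit_of_mul_isUnit_right (e ▸ h.isUnit_geom _ (Nat.mul_pos hcpos hj))
  · rw [← pow_mul]
    exact h.one_sub_pow_ne_zero (Nat.mul_pos hn hd')

theorem ratio_succ (h : IsNearRoot q d) {c : ℕ → ℕ} {v : ℕ → O}
    (hv : ∀ k, v k * ∏ i ∈ Finset.range k, (1 - q ^ (4 * i + 4)) =
      ∏ i ∈ Finset.range k, (1 - q ^ c i)) (k : ℕ) :
    v (k + 1) * (1 - q ^ (4 * k + 4)) = v k * (1 - q ^ c k) := by
  have h1 := hv (k + 1)
  rw [Finset.prod_range_succ, Finset.prod_range_succ, ← hv k] at h1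
  have hne : ∏ i ∈ Finset.range k, (1 - q ^ (4 * i + 4)) ≠ 0 :=
    Finset.prod_ne_zero_iff.2 fun i _ => h.one_sub_pow_ne_zero (by omega)
  apply mul_left_cancel₀ hne
  linear_combination h1

theorem isRatioSeq (h : IsNearRoot q d) {v : ℕ → O}
    (hv : ∀ k, v k * ∏ i ∈ Finset.range k, (1 - q ^ (4 * i + 4)) =
      ∏ i ∈ Finset.range k, (1 - q ^ (4 * i + 2))) : IsRatioSeq q v :=
  ⟨by simpa using hv 0, h.ratio_succ (c := fun i => 4 * i + 2) hv⟩

end IsNearRoot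

namespace IsNearRoot
variable {O : Type*} [CommRing O] {q : O} {m : ℕ}

theorem map_pow_eq_one {A : Type*} [CommRing A] {f : O →+* A} {d : ℕ}
    (hf : ∀ x, f x = 0 ↔ 1 - q ^ d ∣ x) : f q ^ d = 1 := by
  have := (hf _).2 dvd_rfl
  rw [map_sub, map_one, map_pow, sub_eq_zero] at this
  exact this.symm

theorem weight_add {A : Type*} [CommRing A] {x : A} {d : ℕ} (hx : x ^ d = 1)
    (hu : IsUnit (1 - x)) (k : ℕ) : weight x (k + d) = weight x k := by
  apply hu.mul_left_cancel
  rw [one_sub_mul_weight, one_sub_mul_weight]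
  have e1 : x ^ (k + d) ^ 2 = x ^ k ^ 2 := by
    rw [show (k + d) ^ 2 = k ^ 2 + d * (2 * k + d) by ring, pow_add, pow_mul, hx]; simp
  have e2 : x ^ (6 * (k + d) + 1) = x ^ (6 * k + 1) := by
    rw [show 6 * (k + d) + 1 = 6 * k + 1 + d * 6 by ring, pow_add _ _ (d * 6), pow_mul, hx]; simp
  rw [e1, e2]

theorem pow_affine_add {A : Type*} [CommRing A] {x : A} {d : ℕ} (hx : x ^ d = 1) (b c k : ℕ) :
    x ^ (b * (k + d) + c) = x ^ (b * k + c) := by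
  rw [show b * (k + d) + c = b * k + c + d * b by ring, pow_add, pow_mul, hx]; simp

theorem isUnit_one_sub_four {A : Type*} [CommRing A] {x : A}
    (hu : ∀ i, ¬ 2 * m + 1 ∣ i → IsUnit (1 - x ^ i)) (k : ℕ) (hk : ¬ 2 * m + 1 ∣ k + 1) :
    IsUnit (1 - x ^ (4 * k + 4)) := by
  refine hu _ fun h => hk ?_
  have hcop : Nat.Coprime (2 * m + 1) 4 := by
    rw [show 4 = 2 ^ 2 by norm_num]
    exact Nat.Coprime.pow_right 2 (by simp)
  exact hcop.dvd_of_dvd_mul_left (by simpa [mul_add] using h)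

theorem isUnit_map {A : Type*} [CommRing A] (h : IsNearRoot q m) (f : O →+* A) (i : ℕ)
    (hi : ¬ m ∣ i) : IsUnit (1 - f q ^ i) := by
  simpa using (h.isUnit_one_sub i hi).map f

theorem paramSum_one {A : Type*} [CommRing A] {x : A} {u v : ℕ → A}
    (hu : ∀ k, u k * ∏ i ∈ Finset.range k, (1 - x ^ (4 * i + 4)) =
      ∏ i ∈ Finset.range k, (1 - x ^ (2 * i + 1))) (M : ℕ) :
    paramSum x 1 v M = (∑ k ∈ Finset.range (M + 1), weight x k * (u k ^ 2 * v k)) *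
      (∏ i ∈ Finset.range M, (1 - x ^ (4 * i + 4))) ^ 2 := by
  rw [paramSum, ← foldSum_one, ← Finset.prod_pow]
  refine foldSum_mul_prod _ _ _ _ _ _ (fun k _ => ?_) (fun k _ => by rw [paramDen]; ring)
  have e : ∏ i ∈ Finset.range k, paramNum x 1 i =
      (∏ i ∈ Finset.range k, (1 - x ^ (2 * i + 1))) ^ 2 := by
    rw [← Finset.prod_pow]
    exact Finset.prod_congr rfl fun i _ => by rw [paramNum]; ring
  rw [foldTerm, e, ← hu, Finset.prod_pow]
  ring

variable [IsDomain O]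

theorem paramSum_odd_pow (h : IsNearRoot q m) {v : ℕ → O} (hv : IsRatioSeq q v) {M j : ℕ}
    (hj : j ≤ M) : (1 - q) * q ^ j * paramSum q (q ^ (2 * j + 1)) v M =
      (-1) ^ j * (1 - q ^ (2 * j + 1)) *
        ∏ i ∈ Finset.range M, paramDen q (q ^ (2 * j + 1)) i := by
  have hinj := IsFractionRing.injective O (FractionRing O)
  apply hinj
  have hq : Function.Injective fun i : ℕ => algebraMap O (FractionRing O) q ^ i := by
    intro a b hab
    apply h.pow_injective
    apply hinj
    simpa using hab
  have := QDwork.paramSum_odd_pow hq (hv.map (algebraMap O (FractionRing O))) M j hj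
  simpa [map_paramSum, paramDen] using this

variable {A : Type*} [CommRing A] {f : O →+* A}

theorem paramSum_map_one (h : IsNearRoot q (2 * m + 1)) (hm : 0 < m)
    (hf : ∀ x, f x = 0 ↔ 1 - q ^ (2 * m + 1) ∣ x) {v : ℕ → O} (hv : IsRatioSeq q v) :
    paramSum (f q) 1 (fun k => f (v k)) m = 0 := by
  have h1 := congrArg f (h.paramSum_odd_pow hv (le_refl m))
  have hx := map_pow_eq_one hf
  have hu := h.isUnit_map f 1 (by rw [Nat.dvd_one]; omega)
  have hqu := h.isUnit.map f
  rw [map_mul, map_mul, map_mul, map_mul, map_paramSum, map_sub, map_sub, map_pow _ q (2 * m + 1),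
    hx, map_pow, map_one, sub_self, mul_zero, zero_mul] at h1
  rw [pow_one] at hu
  exact ((hu.mul (hqu.pow m)).mul_right_eq_zero).1 h1

/-- The cleared sum with a parameter vanishes modulo `1 - q^d`, coefficient by coefficient. -/
theorem C_dvd_paramSum_aux (h : IsNearRoot q (2 * m + 1)) (hm : 0 < m)
    (hf : ∀ x, f x = 0 ↔ 1 - q ^ (2 * m + 1) ∣ x) {v : ℕ → O}
    (hv : IsRatioSeq q v) (l : ℕ) :
    C (1 - q ^ (2 * m + 1)) ∣
        paramSum (C q) X (fun k => C (v k)) (l * (2 * m + 1) + m) ∧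
      C (1 - q ^ (2 * m + 1)) ∣
        paramSum (C q) X (fun k => C (v k)) (l * (2 * m + 1) + 2 * m) := by
  have hx : f q ^ (2 * m + 1) = 1 := map_pow_eq_one hf
  have hu : ∀ i, ¬ 2 * m + 1 ∣ i → IsUnit (1 - f q ^ i) := h.isUnit_map f
  have hred : ∀ M, C (1 - q ^ (2 * m + 1)) ∣ paramSum (C q) X (fun k => C (v k)) M ↔
      paramSum (C (f q)) X (fun k => C (f (v k))) M = 0 := by
    intro M
    have hmap := map_paramSum (mapRingHom f) (C q) X (fun k => C (v k)) M
    simp only [coe_mapRingHom, map_C, map_X] at hmap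
    rw [← hmap, C_dvd_iff_dvd_coeff, Polynomial.ext_iff]
    simp only [coeff_map, coeff_zero, hf]
  rw [hred, hred]
  have hv' : IsRatioSeq (C (f q)) (fun k => C (f (v k))) := (hv.map f).map C
  have hxC : C (f q) ^ (2 * m + 1) = 1 := by rw [← C_pow, hx, C_1]
  have huC : ∀ i, ¬ 2 * m + 1 ∣ i → IsUnit (1 - C (f q) ^ i) := fun i hi => by
    simpa using (hu i hi).map C
  have hu1 : IsUnit (1 - C (f q)) := by
    simpa using huC 1 (by rw [Nat.dvd_one]; omega)
  have hα : ∀ k, 1 - C (f q) ^ (4 * (k + (2 * m + 1)) + 2) = 1 - C (f q) ^ (4 * k + 2) :=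
    fun k => by rw [pow_affine_add hxC]
  have hβ : ∀ k, 1 - C (f q) ^ (4 * (k + (2 * m + 1)) + 4) = 1 - C (f q) ^ (4 * k + 4) :=
    fun k => by rw [pow_affine_add hxC]
  have hP := paramSum_X_eq_zero hm hx hu (hv.map f) (h.paramSum_map_one hm hf hv)
  have hν : ∀ k, paramNum (C (f q)) X (k + (2 * m + 1)) = paramNum (C (f q)) X k :=
    fun k => by rw [paramNum, paramNum, pow_affine_add hxC]
  have hδ : ∀ k, paramDen (C (f q)) X (k + (2 * m + 1)) = paramDen (C (f q)) X k :=
    fun k => by rw [paramDen, paramDen, pow_affine_add hxC]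
  have hmul := mul_add_eq_of_periodic (v := fun k => C (f (v k)))
    (α := fun k => 1 - C (f q) ^ (4 * k + 2)) (β := fun k => 1 - C (f q) ^ (4 * k + 4))
    hv'.zero hv'.succ hα hβ (isUnit_one_sub_four huC)
  have hαm : 1 - C (f q) ^ (4 * m + 2) = 0 := by
    rw [show 4 * m + 2 = (2 * m + 1) * 2 by ring, pow_mul, hxC, one_pow, sub_self]
  have hzero := eq_zero_of_periodic (v := fun k => C (f (v k)))
    (α := fun k => 1 - C (f q) ^ (4 * k + 2)) (β := fun k => 1 - C (f q) ^ (4 * k + 4)) hv'.succ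
    (isUnit_one_sub_four huC) hαm
  have key := foldSum_block_eq_zero (v := fun k => C (f (v k))) (h := m) (by omega)
    (weight_add hxC hu1) hν hδ hv'.zero hmul (fun j hj hmj => hzero j hj hmj) hP l
  rw [Nat.add_sub_cancel] at key
  exact key

/-- The sum without parameter vanishes modulo `1 - q^d`. -/
theorem dvd_sum_weight_aux (h : IsNearRoot q (2 * m + 1)) (hm : 0 < m)
    (hf : ∀ x, f x = 0 ↔ 1 - q ^ (2 * m + 1) ∣ x) {u v : ℕ → O}
    (hu : ∀ k, u k * ∏ i ∈ Finset.range k, (1 - q ^ (4 * i + 4)) =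
      ∏ i ∈ Finset.range k, (1 - q ^ (2 * i + 1)))
    (hv : IsRatioSeq q v) (l : ℕ) :
    1 - q ^ (2 * m + 1) ∣ ∑ k ∈ Finset.range (l * (2 * m + 1) + m + 1),
        weight q k * (u k ^ 2 * v k) ∧
      1 - q ^ (2 * m + 1) ∣ ∑ k ∈ Finset.range (l * (2 * m + 1) + 2 * m + 1),
        weight q k * (u k ^ 2 * v k) := by
  have hx : f q ^ (2 * m + 1) = 1 := map_pow_eq_one hf
  have hun : ∀ i, ¬ 2 * m + 1 ∣ i → IsUnit (1 - f q ^ i) := h.isUnit_map f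
  have hu1 : IsUnit (1 - f q) := by simpa using hun 1 (by rw [Nat.dvd_one]; omega)
  set w : ℕ → A := fun k => f (u k ^ 2 * v k) with hw
  have hus := h.ratio_succ (c := fun i => 2 * i + 1) hu
  have hred : ∀ M, 1 - q ^ (2 * m + 1) ∣ ∑ k ∈ Finset.range (M + 1),
        weight q k * (u k ^ 2 * v k) ↔
      foldSum (foldTerm (weight (f q)) w (fun _ => 1)) (fun _ => 1) M = 0 := by
    intro M
    rw [foldSum_one, ← hf, map_sum]
    simp [foldTerm, map_weight, hw]
  rw [hred, hred]
  have hw0 : w 0 = 1 := by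
    have := hu 0
    simp only [Finset.range_zero, Finset.prod_empty, mul_one] at this
    simp [hw, this, hv.zero]
  have hws : ∀ k, w (k + 1) * (1 - f q ^ (4 * k + 4)) ^ 3 =
      w k * ((1 - f q ^ (2 * k + 1)) ^ 2 * (1 - f q ^ (4 * k + 2))) := by
    intro k
    have e1 := congrArg f (hus k)
    have e2 := congrArg f (hv.succ k)
    simp only [map_mul, map_sub, map_one, map_pow] at e1 e2
    simp only [hw, map_mul, map_pow]
    linear_combination ((f (u (k + 1)) * (1 - f q ^ (4 * k + 4)) + f (u k) * (1 - f q ^ (2 * k + 1)))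
      * (f (v (k + 1)) * (1 - f q ^ (4 * k + 4)))) * e1 +
      (f (u k) * (1 - f q ^ (2 * k + 1))) ^ 2 * e2
  have hunit : ∀ k, ¬ 2 * m + 1 ∣ k + 1 → IsUnit ((1 - f q ^ (4 * k + 4)) ^ 3) :=
    fun k hk => (isUnit_one_sub_four hun k hk).pow 3
  refine foldSum_block_eq_zero (d := 2 * m + 1) (h := m) (by omega) (weight_add hx hu1)
    (fun _ => rfl) (fun _ => rfl) hw0
    (mul_add_eq_of_periodic hw0 hws (fun k => by rw [pow_affine_add hx, pow_affine_add hx])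
      (fun k => by rw [pow_affine_add hx]) hunit)
    (eq_zero_of_periodic hws hunit (by
      rw [show 4 * m + 2 = (2 * m + 1) * 2 by ring, pow_mul, hx]; simp)) ?_ l
  have hz := h.paramSum_map_one hm hf hv
  rw [paramSum_one (u := fun k => f (u k)) fun k => by simpa using congrArg f (hu k)] at hz
  rw [foldSum_one]
  have hprod : IsUnit (∏ i ∈ Finset.range m, (1 - f q ^ (4 * i + 4))) := by
    rw [IsUnit.prod_iff]
    intro i hi
    refine isUnit_one_sub_four hun i fun hd => ?_
    have := Nat.le_of_dvd (by omega) hd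
    have := Finset.mem_range.1 hi
    omega
  refine (hprod.pow 2).mul_left_eq_zero.1 (Eq.trans ?_ hz)
  simp [foldTerm, hw]

end IsNearRoot

namespace IsNearRoot
variable {O : Type*} [CommRing O] {q : O} {d : ℕ}

theorem exists_eq_block_end {m M : ℕ} (hM : 2 * m + 1 ∣ 2 * M + 1 ∨ 2 * m + 1 ∣ M + 1) :
    ∃ l, M = l * (2 * m + 1) + m ∨ M = l * (2 * m + 1) + 2 * m := by
  rcases hM with ⟨e, he⟩ | ⟨e, he⟩
  · obtain ⟨l, rfl⟩ : Odd e := by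
      have : Odd ((2 * m + 1) * e) := he ▸ odd_two_mul_add_one M
      exact (Nat.odd_mul.1 this).2
    exact ⟨l, Or.inl (by linarith)⟩
  · obtain ⟨l, rfl⟩ : ∃ l, e = l + 1 := Nat.exists_eq_succ_of_ne_zero (by rintro rfl; simp at he)
    exact ⟨l, Or.inr (by linarith)⟩

/-- The cleared sums at `a` and `a⁻¹` agree up to a power of `a`. -/
theorem paramSum_inv {a b : O} (hab : a * b = 1) (v : ℕ → O) (M : ℕ) :
    paramSum q a v M = paramSum q b v M * (a ^ 2) ^ M := by
  have key : ∀ x : O, (1 - b * x) * (b - x) * a ^ 2 = (1 - a * x) * (a - x) := fun x => by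
    linear_combination (a + x^2 * a + x * (-1 - a * b)) * hab
  have := foldSum_mul_prod (foldTerm (weight q) v (paramNum q b)) (paramDen q b)
    (foldTerm (weight q) v (paramNum q a)) (paramDen q a) (fun _ => a ^ 2) M ?_ ?_
  · simpa [paramSum] using this
  · intro k _
    rw [foldTerm, foldTerm, mul_assoc _ (∏ i ∈ Finset.range k, paramNum q b i),
      ← Finset.prod_mul_distrib]
    simp only [paramNum, key]
  · intro k _
    rw [paramDen, paramDen, key]

theorem image_subset_range {n M M' : ℕ} (hn : 0 < n) (hM : n * M' ≤ M) :
    (Finset.range M').image (fun i => n * i + (n - 1)) ⊆ Finset.range M := by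
  intro x hx
  obtain ⟨i, hi, rfl⟩ := Finset.mem_image.1 hx
  have h1 : i + 1 ≤ M' := Finset.mem_range.1 hi
  have h2 := Nat.mul_le_mul_left n h1
  rw [mul_add] at h2
  rw [Finset.mem_range]
  omega

/-- The denominators occurring for `q` but not for `q^n`. -/
def extraDen (q a : O) (n M M' : ℕ) : O :=
  ∏ i ∈ Finset.range M \ (Finset.range M').image (fun i => n * i + (n - 1)), paramDen q a i

theorem prod_paramDen_mul_extraDen (q a : O) {n M M' : ℕ} (hn : 0 < n) (hM : n * M' ≤ M) :
    (∏ i ∈ Finset.range M', paramDen (q ^ n) a i) * extraDen q a n M M' =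
      ∏ i ∈ Finset.range M, paramDen q a i := by
  have hinj : Set.InjOn (fun i => n * i + (n - 1)) (Finset.range M') := fun i _ j _ h =>
    Nat.eq_of_mul_eq_mul_left hn (Nat.add_right_cancel h)
  have hsub := image_subset_range hn hM
  rw [extraDen, ← Finset.prod_sdiff hsub, mul_comm]
  congr 1
  rw [Finset.prod_image hinj]
  refine Finset.prod_congr rfl fun i _ => ?_
  have e : 4 * (n * i + (n - 1)) + 4 = n * (4 * i + 4) := by
    obtain ⟨n, rfl⟩ := Nat.exists_eq_succ_of_ne_zero hn.ne'
    simp only [Nat.succ_eq_add_one, Nat.add_sub_cancel]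
    ring
  rw [paramDen, paramDen, e, pow_mul]

theorem extraDen_inv {a b : O} (hab : a * b = 1) {n M M' : ℕ} (hn : 0 < n) (hM : n * M' ≤ M) :
    extraDen q a n M M' = extraDen q b n M M' * (a ^ 2) ^ (M - M') := by
  have hinj : Set.InjOn (fun i => n * i + (n - 1)) (Finset.range M') := fun i _ j _ h =>
    Nat.eq_of_mul_eq_mul_left hn (Nat.add_right_cancel h)
  have hsub := image_subset_range hn hM
  have key : ∀ x : O, (1 - b * x) * (b - x) * a ^ 2 = (1 - a * x) * (a - x) := fun x => by
    linear_combination (a + x^2 * a + x * (-1 - a * b)) * hab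
  have hcard : (Finset.range M \ (Finset.range M').image (fun i => n * i + (n - 1))).card =
      M - M' := by
    rw [Finset.card_sdiff_of_subset hsub, Finset.card_image_of_injOn hinj]; simp
  rw [extraDen, extraDen, ← hcard, ← Finset.prod_const, ← Finset.prod_mul_distrib]
  exact Finset.prod_congr rfl fun i _ => by rw [paramDen, paramDen, key]

theorem prod_X_sub_C_dvd [IsDomain O] {ι : Type*} (s : Finset ι) (f : ι → O)
    (hf : Set.InjOn f s) {p : O[X]} (hp : ∀ i ∈ s, p.eval (f i) = 0) :
    ∏ i ∈ s, (X - C (f i)) ∣ p := by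
  by_cases h0 : p = 0
  · rw [h0]; exact dvd_zero _
  have hs : (s.val.map f).Nodup := Multiset.Nodup.map_on (fun a ha b hb h => hf ha hb h) s.nodup
  have h1 := (Multiset.prod_X_sub_C_dvd_iff_le_roots h0 (s.val.map f)).2
    ((Multiset.le_iff_subset hs).2 fun x hx => by
      obtain ⟨i, hi, rfl⟩ := Multiset.mem_map.1 hx
      exact (mem_roots h0).2 (hp i hi))
  rwa [Multiset.map_map] at h1

theorem C_dvd_of_monic_mul {c : O} {R S : O[X]} (hR : R.Monic) (h : C c ∣ R * S) : C c ∣ S := by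
  have hred : ∀ P : O[X], C c ∣ P ↔ P.map (Ideal.Quotient.mk (Ideal.span {c})) = 0 := by
    intro P
    rw [C_dvd_iff_dvd_coeff, Polynomial.ext_iff]
    simp only [coeff_map, coeff_zero, Ideal.Quotient.eq_zero_iff_dvd]
  rw [hred] at h ⊢
  rw [Polynomial.map_mul] at h
  apply (hR.map _).isRegular.left
  simpa using h

/-- The difference of the two cleared sums, as a polynomial in the parameter. -/
def diffPoly (q ρ : O) (v v' : ℕ → O) (n M M' : ℕ) : O[X] :=
  paramSum (C q) X (fun k => C (v k)) M -
    C ρ * paramSum (C (q ^ n)) X (fun k => C (v' k)) M' * extraDen (C q) X n M M'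

theorem eval_diffPoly (q ρ : O) (v v' : ℕ → O) (n M M' : ℕ) (a : O) :
    (diffPoly q ρ v v' n M M').eval a =
      paramSum q a v M - ρ * paramSum (q ^ n) a v' M' * extraDen q a n M M' := by
  have h1 := map_paramSum (evalRingHom a) (C q) X (fun k => C (v k)) M
  have h2 := map_paramSum (evalRingHom a) (C (q ^ n)) X (fun k => C (v' k)) M'
  simp only [coe_evalRingHom, eval_C, eval_X] at h1 h2
  rw [diffPoly, eval_sub, eval_mul, eval_mul, h1, h2, eval_C, extraDen, extraDen, eval_prod]
  simp [paramDen]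

theorem one_sub_dvd_geom (h : IsNearRoot q d) (hd : 1 < d) {n : ℕ} (hn : d / d.gcd n = 1) :
    1 - q ^ d ∣ ∑ i ∈ Finset.range n, q ^ i := by
  have hdn : d ∣ n := by
    have := Nat.div_mul_cancel (Nat.gcd_dvd_left d n)
    rw [hn, one_mul] at this
    exact this ▸ Nat.gcd_dvd_right d n
  obtain ⟨c, rfl⟩ := hdn
  have hu : IsUnit (1 - q) := by simpa using h.isUnit_one_sub 1 (by rw [Nat.dvd_one]; omega)
  rw [← hu.dvd_mul_left, mul_neg_geom_sum, one_sub_pow_mul]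
  exact dvd_mul_right _ _

variable [IsDomain O]

theorem C_dvd_paramSum (h : IsNearRoot q d) (hodd : Odd d) (hd : 1 < d) {v : ℕ → O}
    (hv : IsRatioSeq q v) {M : ℕ} (hM : d ∣ 2 * M + 1 ∨ d ∣ M + 1) :
    C (1 - q ^ d) ∣ paramSum (C q) X (fun k => C (v k)) M := by
  obtain ⟨m, rfl⟩ := hodd
  obtain ⟨l, hl⟩ := exists_eq_block_end hM
  have key := h.C_dvd_paramSum_aux (by omega) (f := Ideal.Quotient.mk _)
    (fun x => Ideal.Quotient.eq_zero_iff_dvd _ _) hv l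
  rcases hl with rfl | rfl
  exacts [key.1, key.2]

theorem dvd_sum_weight (h : IsNearRoot q d) (hodd : Odd d) (hd : 1 < d) {u v : ℕ → O}
    (hu : ∀ k, u k * ∏ i ∈ Finset.range k, (1 - q ^ (4 * i + 4)) =
      ∏ i ∈ Finset.range k, (1 - q ^ (2 * i + 1)))
    (hv : IsRatioSeq q v) {M : ℕ} (hM : d ∣ 2 * M + 1 ∨ d ∣ M + 1) :
    1 - q ^ d ∣ ∑ k ∈ Finset.range (M + 1), weight q k * (u k ^ 2 * v k) := by
  obtain ⟨m, rfl⟩ := hodd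
  obtain ⟨l, hl⟩ := exists_eq_block_end hM
  have key := h.dvd_sum_weight_aux (by omega) (f := Ideal.Quotient.mk _)
    (fun x => Ideal.Quotient.eq_zero_iff_dvd _ _) hu hv l
  rcases hl with rfl | rfl
  exacts [key.1, key.2]

theorem eval_diffPoly_odd_pow (h : IsNearRoot q d) {c n M M' j : ℕ} (hn : n = 2 * c + 1)
    {v v' : ℕ → O} (hv : IsRatioSeq q v) (hv' : IsRatioSeq (q ^ n) v') {ρ : O}
    (hρ : (1 - q) * (q ^ c * ρ) = (-1) ^ c * (1 - q ^ n)) (hMM : n * M' ≤ M)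
    (hj : j ≤ M') (hjM : j * n + c ≤ M) :
    (diffPoly q ρ v v' n M M').eval (q ^ ((2 * j + 1) * n)) = 0 := by
  have hn0 : 0 < n := by omega
  have h1 := h.paramSum_odd_pow hv hjM
  have h2 := (h.pow hn0).paramSum_odd_pow hv' hj
  have e1 : 2 * (j * n + c) + 1 = (2 * j + 1) * n := by rw [hn]; ring
  have e2 : (q ^ n) ^ (2 * j + 1) = q ^ ((2 * j + 1) * n) := by rw [← pow_mul, mul_comm]
  have e3 : (-1 : O) ^ (j * n + c) = (-1) ^ j * (-1) ^ c := by
    rw [pow_add, hn, mul_comm j, pow_mul, Odd.neg_one_pow (odd_two_mul_add_one c)]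
  rw [e1, e3] at h1
  rw [e2] at h2
  have hD := prod_paramDen_mul_extraDen q (q ^ ((2 * j + 1) * n)) hn0 hMM
  have hne : (1 - q) * q ^ (j * n + c) ≠ 0 :=
    mul_ne_zero (by simpa using h.one_sub_pow_ne_zero one_pos) (h.isUnit.pow _).ne_zero
  rw [eval_diffPoly]
  apply mul_left_cancel₀ hne
  rw [mul_zero]
  set a := q ^ ((2 * j + 1) * n)
  have e4 : (q ^ n) ^ j = q ^ (j * n) := by rw [← pow_mul, mul_comm]
  rw [e4] at h2
  rw [pow_add] at h1 ⊢
  linear_combination h1 - q ^ (j * n) * paramSum (q ^ n) a v' M' * extraDen q a n M M' * hρ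
    - (-1) ^ c * extraDen q a n M M' * h2 - (-1) ^ j * (-1) ^ c * (1 - a) * hD

theorem eval_diffPoly_inv {a b : O} (hab : a * b = 1) (ρ : O) (v v' : ℕ → O) {n M M' : ℕ}
    (hn : 0 < n) (hMM : n * M' ≤ M) (h0 : (diffPoly q ρ v v' n M M').eval a = 0) :
    (diffPoly q ρ v v' n M M').eval b = 0 := by
  rw [eval_diffPoly] at h0 ⊢
  rw [paramSum_inv hab, paramSum_inv hab, extraDen_inv hab hn hMM] at h0
  have hM : M' + (M - M') = M := by
    have := Nat.le_mul_of_pos_left M' hn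
    omega
  have ha : (a ^ 2) ^ M ≠ 0 := by
    have : a ≠ 0 := by rintro rfl; simp at hab
    positivity
  apply mul_right_cancel₀ ha
  rw [zero_mul, ← h0, sub_mul, ← hM, pow_add, hM]
  ring

end IsNearRoot

namespace IsNearRoot
variable {O : Type*} [CommRing O] [IsDomain O] {q : O} {d n M M' : ℕ} {ρ : O} {u v u' v' : ℕ → O}

theorem odd_div_gcd (hodd : Odd d) (n : ℕ) : Odd (d / d.gcd n) := by
  rw [← Nat.div_mul_cancel (Nat.gcd_dvd_left d n)] at hodd
  exact (Nat.odd_mul.1 hodd).1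

theorem C_dvd_diffPoly (h : IsNearRoot q d) (hodd : Odd d) (hd : 1 < d) (hn : 0 < n)
    (hv : IsRatioSeq q v) (hv' : IsRatioSeq (q ^ n) v')
    (hρ : d / d.gcd n = 1 → 1 - q ^ d ∣ ρ) (hM : d ∣ 2 * M + 1 ∨ d ∣ M + 1)
    (hM' : d / d.gcd n ∣ 2 * M' + 1 ∨ d / d.gcd n ∣ M' + 1) :
    C (1 - q ^ d) ∣ diffPoly q ρ v v' n M M' := by
  refine dvd_sub (h.C_dvd_paramSum hodd hd hv hM) (Dvd.dvd.mul_right ?_ _)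
  have h' := h.pow hn
  by_cases h1 : d / d.gcd n = 1
  · exact ((map_dvd C (hρ h1))).mul_right _
  · have := h'.pos
    exact ((map_dvd C (one_sub_dvd_pow q d n)).trans
      (h'.C_dvd_paramSum (odd_div_gcd hodd n) (by omega) hv' hM')).mul_left _

theorem dvd_sub_sum_weight (h : IsNearRoot q d) (hodd : Odd d) (hd : 1 < d) (hn : 0 < n)
    (hu : ∀ k, u k * ∏ i ∈ Finset.range k, (1 - q ^ (4 * i + 4)) =
      ∏ i ∈ Finset.range k, (1 - q ^ (2 * i + 1)))
    (hu' : ∀ k, u' k * ∏ i ∈ Finset.range k, (1 - (q ^ n) ^ (4 * i + 4)) =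
      ∏ i ∈ Finset.range k, (1 - (q ^ n) ^ (2 * i + 1)))
    (hv : IsRatioSeq q v) (hv' : IsRatioSeq (q ^ n) v')
    (hρ : d / d.gcd n = 1 → 1 - q ^ d ∣ ρ) (hM : d ∣ 2 * M + 1 ∨ d ∣ M + 1)
    (hM' : d / d.gcd n ∣ 2 * M' + 1 ∨ d / d.gcd n ∣ M' + 1) :
    1 - q ^ d ∣ (∑ k ∈ Finset.range (M + 1), weight q k * (u k ^ 2 * v k)) -
      ρ * ∑ k ∈ Finset.range (M' + 1), weight (q ^ n) k * (u' k ^ 2 * v' k) := by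
  refine dvd_sub (h.dvd_sum_weight hodd hd hu hv hM) ?_
  have h' := h.pow hn
  by_cases h1 : d / d.gcd n = 1
  · exact (hρ h1).mul_right _
  · have := h'.pos
    exact ((one_sub_dvd_pow q d n).trans
      (h'.dvd_sum_weight (odd_div_gcd hodd n) (by omega) hu' hv' hM')).mul_left _

theorem pow_three_dvd_sub_sum_weight (h : IsNearRoot q d) (hodd : Odd d) (hd : 1 < d)
    {c : ℕ} (hn : n = 2 * c + 1)
    (hu : ∀ k, u k * ∏ i ∈ Finset.range k, (1 - q ^ (4 * i + 4)) =
      ∏ i ∈ Finset.range k, (1 - q ^ (2 * i + 1)))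
    (hu' : ∀ k, u' k * ∏ i ∈ Finset.range k, (1 - (q ^ n) ^ (4 * i + 4)) =
      ∏ i ∈ Finset.range k, (1 - (q ^ n) ^ (2 * i + 1)))
    (hv : IsRatioSeq q v) (hv' : IsRatioSeq (q ^ n) v')
    (hρ : d / d.gcd n = 1 → 1 - q ^ d ∣ ρ) (hM : d ∣ 2 * M + 1 ∨ d ∣ M + 1)
    (hM' : d / d.gcd n ∣ 2 * M' + 1 ∨ d / d.gcd n ∣ M' + 1)
    (hρ' : (1 - q) * (q ^ c * ρ) = (-1) ^ c * (1 - q ^ n)) (hMM : M' * n + c ≤ M)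
    (hcount : M / d + 1 ≤ ((Finset.range (M' + 1)).filter fun j => d ∣ (2 * j + 1) * n).card) :
    (1 - q ^ d) ^ 3 ∣ (∑ k ∈ Finset.range (M + 1), weight q k * (u k ^ 2 * v k)) -
      ρ * ∑ k ∈ Finset.range (M' + 1), weight (q ^ n) k * (u' k ^ 2 * v' k) := by
  have hn0 : 0 < n := by omega
  have hMM' : n * M' ≤ M := by rw [mul_comm]; omega
  obtain ⟨p, hp⟩ := h.isUnit
  have hpi : q * (↑p⁻¹ : O) = 1 := by rw [← hp]; exact p.mul_inv
  set b : O := ↑p⁻¹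
  have hpow : ∀ k, q ^ k * b ^ k = 1 := fun k => by rw [← mul_pow, hpi, one_pow]
  set P := diffPoly q ρ v v' n M M' with hP
  set N : ℕ → ℕ := fun j => (2 * j + 1) * n with hN
  have hNinj : Function.Injective N := fun i j hij => by
    have := Nat.eq_of_mul_eq_mul_right hn0 hij
    omega
  have hNpos : ∀ j, 0 < N j := fun j => Nat.mul_pos (by omega) hn0
  have hz1 : ∀ j ∈ Finset.range (M' + 1), P.eval (q ^ N j) = 0 := by
    intro j hj
    have hj' : j ≤ M' := by have := Finset.mem_range.1 hj; omega
    have := Nat.mul_le_mul_right n hj'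
    exact h.eval_diffPoly_odd_pow hn hv hv' hρ' hMM' hj' (by omega)
  have hz2 : ∀ j ∈ Finset.range (M' + 1), P.eval (b ^ N j) = 0 := fun j hj =>
    eval_diffPoly_inv (hpow _) ρ v v' hn0 hMM' (hz1 j hj)
  obtain ⟨S, hS⟩ := prod_X_sub_C_dvd (Finset.range (M' + 1)) (fun j => q ^ N j)
    (fun i _ j _ hij => hNinj (h.pow_injective hij)) hz1
  have hbinj : ∀ i j, b ^ N i = b ^ N j → i = j := by
    intro i j hij
    apply hNinj
    apply h.pow_injective
    have h1 := hpow (N i)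
    have h2 := hpow (N j)
    change q ^ N i = q ^ N j
    rw [hij] at h1
    linear_combination q ^ N i * (-h2) + q ^ N j * h1
  have hS0 : ∀ j ∈ Finset.range (M' + 1), S.eval (b ^ N j) = 0 := by
    intro j hj
    have h1 := hz2 j hj
    rw [hS, eval_mul, eval_prod] at h1
    refine (mul_eq_zero.1 h1).resolve_left (Finset.prod_ne_zero_iff.2 fun i _ => ?_)
    rw [eval_sub, eval_X, eval_C]
    intro h2
    apply h.one_sub_pow_ne_zero (show 0 < N i + N j by have := hNpos i; omega)
    rw [pow_add]
    linear_combination q ^ N j * h2 - hpow (N j)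
  obtain ⟨S', hS'⟩ := prod_X_sub_C_dvd (Finset.range (M' + 1)) (fun j => b ^ N j)
    (fun i _ j _ hij => hbinj i j hij) hS0
  have hdvd := h.C_dvd_diffPoly hodd hd hn0 hv hv' hρ hM hM'
  rw [← hP, hS] at hdvd
  have hdvd' := C_dvd_of_monic_mul (monic_prod_of_monic _ _ fun i _ => monic_X_sub_C _) hdvd
  rw [hS'] at hdvd'
  obtain ⟨T, hT⟩ := C_dvd_of_monic_mul (monic_prod_of_monic _ _ fun i _ => monic_X_sub_C _) hdvd'
  have hP1 : P.eval 1 = (∏ j ∈ Finset.range (M' + 1), (1 - q ^ N j)) *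
      ((∏ j ∈ Finset.range (M' + 1), (1 - b ^ N j)) * ((1 - q ^ d) * T.eval 1)) := by
    rw [hS, hS', hT]
    simp [eval_prod]
  have hbq : ∏ j ∈ Finset.range (M' + 1), (1 - b ^ N j) =
      (∏ j ∈ Finset.range (M' + 1), -b ^ N j) * ∏ j ∈ Finset.range (M' + 1), (1 - q ^ N j) := by
    rw [← Finset.prod_mul_distrib]
    exact Finset.prod_congr rfl fun j _ => by linear_combination -hpow (N j)
  obtain ⟨w, -, hw⟩ := h.prod_one_sub_pow (Finset.range (M' + 1)) N fun j _ => hNpos j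
  obtain ⟨r, hr⟩ := Nat.exists_eq_add_of_le hcount
  rw [hr] at hw
  obtain ⟨y, hy, hD⟩ := h.prod_one_sub_pow (Finset.range M) (fun i => 4 * i + 4) (by simp)
  rw [card_filter_dvd_four_mul hodd] at hD
  have hE := prod_paramDen_mul_extraDen q (1 : O) hn0 hMM'
  have hsq : ∀ (x : O) (m : ℕ), ∏ i ∈ Finset.range m, paramDen x 1 i =
      (∏ i ∈ Finset.range m, (1 - x ^ (4 * i + 4))) ^ 2 := by
    intro x m
    rw [← Finset.prod_pow]
    exact Finset.prod_congr rfl fun i _ => by rw [paramDen]; ring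
  rw [hsq, hsq] at hE
  rw [hP, eval_diffPoly, paramSum_one hu, paramSum_one hu', hbq, hw] at hP1
  rw [hD] at hP1 hE
  set S₁ := ∑ k ∈ Finset.range (M + 1), weight q k * (u k ^ 2 * v k)
  set S₂ := ∑ k ∈ Finset.range (M' + 1), weight (q ^ n) k * (u' k ^ 2 * v' k)
  set π := 1 - q ^ d with hπ
  have hπ0 : (π ^ (M / d)) ^ 2 ≠ 0 := pow_ne_zero _ (pow_ne_zero _ h.ne_zero)
  rw [← (hy.pow 2).dvd_mul_left]
  set z := ∏ j ∈ Finset.range (M' + 1), -b ^ N j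
  refine ⟨w ^ 2 * (π ^ r) ^ 2 * z * T.eval 1, ?_⟩
  apply mul_left_cancel₀ hπ0
  rw [pow_add, pow_succ] at hP1
  linear_combination hP1 + ρ * S₂ * hE

end IsNearRoot

/-- The rational functions with integer coefficients that are defined at `ζ`. -/
def regularAt (ζ : ℂ) : Subring (RatFunc ℤ) where
  carrier := {f | ∃ N D : ℤ[X], aeval ζ D ≠ 0 ∧ f * algebraMap ℤ[X] (RatFunc ℤ) D =
    algebraMap ℤ[X] (RatFunc ℤ) N}
  mul_mem' := by
    rintro f g ⟨N, D, hD, hf⟩ ⟨N', D', hD', hg⟩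
    refine ⟨N * N', D * D', by simpa using ⟨hD, hD'⟩, ?_⟩
    rw [map_mul, map_mul, ← hf, ← hg]; ring
  one_mem' := ⟨1, 1, by simp, by simp⟩
  add_mem' := by
    rintro f g ⟨N, D, hD, hf⟩ ⟨N', D', hD', hg⟩
    refine ⟨N * D' + N' * D, D * D', by simpa using ⟨hD, hD'⟩, ?_⟩
    rw [map_mul, map_add, map_mul, map_mul, ← hf, ← hg]; ring
  zero_mem' := ⟨0, 1, by simp, by simp⟩
  neg_mem' := by
    rintro f ⟨N, D, hD, hf⟩
    exact ⟨-N, D, hD, by rw [map_neg, ← hf]; ring⟩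

/-- The inclusion of the polynomials. -/
def polyAt (ζ : ℂ) : ℤ[X] →+* regularAt ζ :=
  (algebraMap ℤ[X] (RatFunc ℤ)).codRestrict (regularAt ζ) fun P => ⟨P, 1, by simp, by simp⟩

theorem coe_polyAt (ζ : ℂ) (P : ℤ[X]) :
    (polyAt ζ P : RatFunc ℤ) = algebraMap ℤ[X] (RatFunc ℤ) P := rfl

theorem isUnit_polyAt {ζ : ℂ} {P : ℤ[X]} (hP : aeval ζ P ≠ 0) : IsUnit (polyAt ζ P) := by
  have h0 : algebraMap ℤ[X] (RatFunc ℤ) P ≠ 0 := by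
    rw [Ne, map_eq_zero_iff _ (RatFunc.algebraMap_injective ℤ)]
    rintro rfl
    simp at hP
  refine IsUnit.of_mul_eq_one ⟨(algebraMap ℤ[X] (RatFunc ℤ) P)⁻¹, 1, P, hP, ?_⟩ ?_
  · rw [inv_mul_cancel₀ h0, map_one]
  · apply Subtype.ext
    exact mul_inv_cancel₀ h0

theorem isNearRoot_polyAt {ζ : ℂ} {d : ℕ} (hd : 0 < d) (hζ : IsPrimitiveRoot ζ d) :
    IsNearRoot (polyAt ζ X) d := by
  refine ⟨isUnit_polyAt ?_, fun i hi => ?_, fun j hj => ?_, ?_⟩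
  · simpa using hζ.ne_zero hd.ne'
  · have := isUnit_polyAt (ζ := ζ) (P := 1 - X ^ i) (by
      simp only [map_sub, map_one, map_pow, aeval_X]
      exact fun h => hi (hζ.dvd_of_pow_eq_one i (sub_eq_zero.1 h).symm))
    simpa using this
  · have := isUnit_polyAt (ζ := ζ) (P := ∑ i ∈ Finset.range j, (X ^ d) ^ i) (by
      simp [hζ.pow_eq_one]; omega)
    simpa using this
  · intro h
    have h1 := congrArg Subtype.val h
    have h2 : algebraMap ℤ[X] (RatFunc ℤ) (1 - X ^ d) = algebraMap ℤ[X] (RatFunc ℤ) 0 := by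
      simpa [coe_polyAt] using h1
    have h3 := congrArg (eval 0) (RatFunc.algebraMap_injective ℤ h2)
    simp [hd.ne'] at h3

theorem cyclotomic_dvd_iff {ζ : ℂ} {d : ℕ} (hd : 0 < d) (hζ : IsPrimitiveRoot ζ d) (P : ℤ[X]) :
    cyclotomic d ℤ ∣ P ↔ aeval ζ P = 0 := by
  rw [cyclotomic_eq_minpoly hζ hd, minpoly.isIntegrallyClosed_dvd_iff (hζ.isIntegral hd)]

theorem cyclotomic_pow_dvd_num {ζ : ℂ} {d e : ℕ} (hd : 0 < d) (hζ : IsPrimitiveRoot ζ d)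
    {N D : ℤ[X]} (hD : D ≠ 0) {s : regularAt ζ} (hs : (1 - polyAt ζ X ^ d) ^ e ∣ s)
    (h : (s : RatFunc ℤ) = algebraMap ℤ[X] (RatFunc ℤ) N / algebraMap ℤ[X] (RatFunc ℤ) D) :
    cyclotomic d ℤ ^ e ∣ N := by
  obtain ⟨⟨t, N', D', hD', ht⟩, rfl⟩ := hs
  have hD0 : algebraMap ℤ[X] (RatFunc ℤ) D ≠ 0 := by
    rwa [Ne, map_eq_zero_iff _ (RatFunc.algebraMap_injective ℤ)]
  rw [eq_div_iff hD0] at h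
  have hx : ((polyAt ζ X : regularAt ζ) : RatFunc ℤ) = algebraMap ℤ[X] (RatFunc ℤ) X := rfl
  simp only [Subring.coe_mul, Subring.coe_pow, AddSubgroupClass.coe_sub, Subring.coe_one, hx] at h
  have key : N * D' = (1 - X ^ d) ^ e * (N' * D) := by
    apply RatFunc.algebraMap_injective ℤ
    simp only [map_mul, map_pow, map_sub, map_one]
    rw [← h, ← ht]
    ring
  have hp : Prime (cyclotomic d ℤ) := (cyclotomic.irreducible hd).prime
  refine hp.pow_dvd_of_dvd_mul_right e ((cyclotomic_dvd_iff hd hζ D').not.2 hD') ?_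
  rw [key]
  refine (pow_dvd_pow_of_dvd ?_ e).mul_right _
  rw [cyclotomic_dvd_iff hd hζ]
  simp [hζ.pow_eq_one]

theorem modulus_dvd {n r : ℕ} (hn : 1 < n) {N : ℤ[X]}
    (h1 : ∀ d, d ∣ n ^ r → 1 < d → cyclotomic d ℤ ∣ N)
    (h3 : ∀ j ∈ Finset.Icc 1 r, cyclotomic (n ^ j) ℤ ^ 3 ∣ N) : modulus n r ∣ N := by
  classical
  have hinj : Set.InjOn (fun j => n ^ j) (Finset.Icc 1 r) := fun i _ j _ h =>
    Nat.pow_right_injective hn h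
  have hne : n ^ r ≠ 0 := pow_ne_zero _ (by omega)
  have hsub : (Finset.Icc 1 r).image (fun j => n ^ j) ⊆ (n ^ r).divisors.erase 1 := by
    intro d hd
    obtain ⟨j, hj, rfl⟩ := Finset.mem_image.1 hd
    rw [Finset.mem_Icc] at hj
    simp only [Finset.mem_erase, Nat.mem_divisors]
    exact ⟨(Nat.one_lt_pow (by omega) hn).ne', pow_dvd_pow n hj.2, hne⟩
  have e : modulus n r = ∏ d ∈ (n ^ r).divisors.erase 1, cyclotomic d ℤ ^
      (1 + if d ∈ (Finset.Icc 1 r).image (fun j => n ^ j) then 2 else 0) := by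
    rw [modulus, ← prod_cyclotomic_eq_geom_sum (Nat.pos_of_ne_zero hne),
      ← Finset.prod_image (f := fun d => cyclotomic d ℤ ^ 2) hinj]
    simp only [pow_add, pow_one, Finset.prod_mul_distrib]
    congr 1
    rw [← Finset.prod_subset hsub]
    · exact Finset.prod_congr rfl fun d hd => by rw [if_pos hd]
    · intro d _ hd
      rw [if_neg hd, pow_zero]
  rw [e]
  have hpos : ∀ d ∈ (n ^ r).divisors.erase 1, d ∣ n ^ r ∧ 1 < d := by
    intro d hd
    simp only [Finset.mem_erase, Nat.mem_divisors] at hd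
    have := Nat.pos_of_dvd_of_pos hd.2.1 (Nat.pos_of_ne_zero hne)
    exact ⟨hd.2.1, by omega⟩
  apply Finset.prod_dvd_of_isRelPrime
  · intro a ha b hb hab
    apply IsRelPrime.pow
    have ha' := hpos a ha
    have hb' := hpos b hb
    rw [(cyclotomic.irreducible (by omega)).isRelPrime_iff_not_dvd]
    intro hd
    have := (cyclotomic.irreducible (by omega)).associated_of_dvd (cyclotomic.irreducible
      (by omega)) hd
    exact hab (cyclotomic_injective
      (eq_of_monic_of_associated (cyclotomic.monic a ℤ) (cyclotomic.monic b ℤ) this))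
  · intro d hd
    split_ifs with hc
    · obtain ⟨j, hj, rfl⟩ := Finset.mem_image.1 hc
      exact h3 j hj
    · simpa using h1 d (hpos d hd).1 (hpos d hd).2

theorem truncatedSum_eq {O K : Type*} [CommRing O] [Field K] (φ : O →+* K)
    (hφ : Function.Injective φ) {q : O} (hq : ∀ i, 0 < i → 1 - q ^ i ≠ 0) {u v : ℕ → O}
    (hu : ∀ k, u k * ∏ i ∈ Finset.range k, (1 - q ^ (4 * i + 4)) =
      ∏ i ∈ Finset.range k, (1 - q ^ (2 * i + 1)))
    (hv : ∀ k, v k * ∏ i ∈ Finset.range k, (1 - q ^ (4 * i + 4)) =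
      ∏ i ∈ Finset.range k, (1 - q ^ (4 * i + 2))) (M : ℕ) :
    truncatedSum (φ q) M = φ (∑ k ∈ Finset.range (M + 1), weight q k * (u k ^ 2 * v k)) := by
  rw [truncatedSum, map_sum]
  refine Finset.sum_congr rfl fun k _ => ?_
  have e1 : qPochhammer (φ q) (φ q ^ 2) k = φ (∏ i ∈ Finset.range k, (1 - q ^ (2 * i + 1))) := by
    rw [qPochhammer, map_prod]
    refine Finset.prod_congr rfl fun i _ => ?_
    simp; ring
  have e2 : qPochhammer (φ q ^ 2) (φ q ^ 4) k =
      φ (∏ i ∈ Finset.range k, (1 - q ^ (4 * i + 2))) := by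
    rw [qPochhammer, map_prod]
    refine Finset.prod_congr rfl fun i _ => ?_
    simp; ring
  have e3 : qPochhammer (φ q ^ 4) (φ q ^ 4) k =
      φ (∏ i ∈ Finset.range k, (1 - q ^ (4 * i + 4))) := by
    rw [qPochhammer, map_prod]
    refine Finset.prod_congr rfl fun i _ => ?_
    simp; ring
  have hne : φ (∏ i ∈ Finset.range k, (1 - q ^ (4 * i + 4))) ≠ 0 := by
    rw [map_prod]
    exact Finset.prod_ne_zero_iff.2 fun i _ => by
      rw [Ne, map_eq_zero_iff _ hφ]
      exact hq _ (by omega)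
  have ew : φ (weight q k) = φ q ^ k ^ 2 * qInt (6 * k + 1) (φ q) := by
    simp [weight, qInt]
  rw [e1, e2, e3, ← hu, ← hv, map_mul φ (weight q k), ew]
  congr 1
  rw [div_eq_iff (pow_ne_zero _ hne)]
  simp only [map_mul, map_pow]
  ring

/-- The pairs of truncation points `((n^r - 1)/2, (n^(r-1) - 1)/2)` and `(n^r - 1, n^(r-1) - 1)`. -/
def IsTruncationPair (n r M M' : ℕ) : Prop :=
  (2 * M + 1 = n ^ r ∧ 2 * M' + 1 = n ^ (r - 1)) ∨ (M + 1 = n ^ r ∧ M' + 1 = n ^ (r - 1))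

namespace IsTruncationPair
variable {n r M M' : ℕ}

theorem dvd_left (h : IsTruncationPair n r M M') {d : ℕ} (hd : d ∣ n ^ r) :
    d ∣ 2 * M + 1 ∨ d ∣ M + 1 := by
  rcases h with ⟨h, -⟩ | ⟨h, -⟩ <;> rw [h]
  exacts [Or.inl hd, Or.inr hd]

theorem dvd_right (h : IsTruncationPair n r M M') (hr : 1 ≤ r) (hn : 0 < n) {d : ℕ}
    (hd : d ∣ n ^ r) : d / d.gcd n ∣ 2 * M' + 1 ∨ d / d.gcd n ∣ M' + 1 := by
  have hg : 0 < d.gcd n := Nat.gcd_pos_of_pos_right _ hn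
  have key : d / d.gcd n ∣ n ^ (r - 1) := by
    apply (Nat.coprime_div_gcd_div_gcd hg).dvd_of_dvd_mul_left
    rw [← Nat.mul_dvd_mul_iff_left hg, Nat.mul_div_cancel' (Nat.gcd_dvd_left d n), ← mul_assoc,
      Nat.mul_div_cancel' (Nat.gcd_dvd_right d n), ← pow_succ', Nat.sub_add_cancel hr]
    exact hd
  rcases h with ⟨-, h⟩ | ⟨-, h⟩ <;> rw [h]
  exacts [Or.inl key, Or.inr key]

theorem mul_add_le (h : IsTruncationPair n r M M') (hr : 1 ≤ r) {c : ℕ} (hn : n = 2 * c + 1) :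
    M' * n + c ≤ M := by
  have hp : n ^ r = n ^ (r - 1) * n := by rw [← pow_succ, Nat.sub_add_cancel hr]
  rcases h with ⟨h, h'⟩ | ⟨h, h'⟩
  · rw [hp, ← h'] at h
    have : (2 * M' + 1) * n = 2 * (M' * n) + n := by ring
    omega
  · rw [hp, ← h'] at h
    have : (M' + 1) * n = M' * n + n := by ring
    omega

theorem le_card (h : IsTruncationPair n r M M') {j : ℕ} (hj : j ∈ Finset.Icc 1 r)
    (hodd : Odd n) : M / n ^ j + 1 ≤
      ((Finset.range (M' + 1)).filter fun i => n ^ j ∣ (2 * i + 1) * n).card := by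
  rw [Finset.mem_Icc] at hj
  obtain ⟨g, hg⟩ := hodd.pow (n := j - 1)
  have hnj : n ^ j = (2 * g + 1) * n := by rw [← hg, ← pow_succ, Nat.sub_add_cancel hj.1]
  have e1 : n ^ r = n ^ (r - j) * n ^ j := by rw [← pow_add, Nat.sub_add_cancel hj.2]
  have e2 : n ^ (r - 1) = n ^ (r - j) * (2 * g + 1) := by
    rw [← hg, ← pow_add]; congr 1; omega
  have hpos : 0 < n ^ j := Nat.pow_pos hodd.pos
  rw [← Finset.card_range (M / n ^ j + 1)]
  refine Finset.card_le_card_of_injOn (fun t => t * (2 * g + 1) + g) ?_ ?_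
  · intro t ht
    have ht' : t ≤ M / n ^ j := by
      have := Finset.mem_range.1 (Finset.mem_coe.1 ht); omega
    have htM := (Nat.le_div_iff_mul_le hpos).1 ht'
    simp only [Finset.coe_filter, Finset.mem_range, Set.mem_ofPred_eq]
    refine ⟨?_, 2 * t + 1, by rw [hnj]; ring⟩
    rcases h with ⟨h, h'⟩ | ⟨h, h'⟩
    · rw [e1] at h
      rw [e2] at h'
      have h1 : 2 * t < n ^ (r - j) := by
        by_contra hc
        have := Nat.mul_le_mul_right (n ^ j) (not_lt.1 hc)
        rw [mul_assoc] at this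
        omega
      have h2 := Nat.mul_le_mul_right (2 * g + 1) h1
      have h3 : (2 * t).succ * (2 * g + 1) = 2 * (t * (2 * g + 1) + g) + 1 := by
        rw [Nat.succ_eq_add_one]; ring
      omega
    · rw [e1] at h
      rw [e2] at h'
      have h1 : t < n ^ (r - j) := by
        by_contra hc
        have := Nat.mul_le_mul_right (n ^ j) (not_lt.1 hc)
        omega
      have h2 := Nat.mul_le_mul_right (2 * g + 1) h1
      have h3 : t.succ * (2 * g + 1) = t * (2 * g + 1) + (2 * g + 1) := by
        rw [Nat.succ_eq_add_one]; ring
      omega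
  · intro t _ t' _ he
    simp only [add_left_inj] at he
    exact Nat.eq_of_mul_eq_mul_right (by omega) he

/-- The difference of the two truncated sums, in a ring where `x` comes from a near root. -/
theorem exists_eq_sub (h : IsTruncationPair n r M M') (hodd : Odd n) (hr : 1 ≤ r)
    {O K : Type*} [CommRing O] [IsDomain O] [Field K] {φ : O →+* K} (hφ : Function.Injective φ)
    {q : O} {d : ℕ} (hq : IsNearRoot q d) (hd : d ∣ n ^ r) (hd1 : 1 < d) :
    ∃ s : O, φ s = truncatedSum (φ q) M -
        ((-(φ q)) ^ ((1 - (n : ℤ)) / 2) * qInt n (φ q) * truncatedSum ((φ q) ^ n) M') ∧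
      1 - q ^ d ∣ s ∧ (∀ j ∈ Finset.Icc 1 r, d = n ^ j → (1 - q ^ d) ^ 3 ∣ s) := by
  obtain ⟨c, hc⟩ := hodd
  have hn0 : 0 < n := by omega
  have hdodd : Odd d := Odd.of_dvd_nat (Odd.pow ⟨c, hc⟩) hd
  have hq' := hq.pow hn0
  have hdodd' := IsNearRoot.odd_div_gcd hdodd n
  obtain ⟨v, hv⟩ := hq.exists_ratio_four hdodd
  obtain ⟨u, hu⟩ := hq.exists_ratio_two hdodd
  obtain ⟨v', hv'⟩ := hq'.exists_ratio_four hdodd'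
  obtain ⟨u', hu'⟩ := hq'.exists_ratio_two hdodd'
  obtain ⟨b, hqb⟩ := hq.isUnit.exists_right_inv
  set ρ := (-b) ^ c * ∑ i ∈ Finset.range n, q ^ i with hρdef
  have hρ : d / d.gcd n = 1 → 1 - q ^ d ∣ ρ := fun h1 =>
    (hq.one_sub_dvd_geom hd1 h1).mul_left _
  have hρ' : (1 - q) * (q ^ c * ρ) = (-1) ^ c * (1 - q ^ n) := by
    rw [← mul_neg_geom_sum, hρdef]
    have : q ^ c * (-b) ^ c = (-1) ^ c := by rw [← mul_pow, mul_neg, hqb]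
    linear_combination ((1 - q) * ∑ i ∈ Finset.range n, q ^ i) * this
  have hA := truncatedSum_eq φ hφ (fun i hi => hq.one_sub_pow_ne_zero hi) hu hv M
  have hB := truncatedSum_eq φ hφ (fun i hi => hq'.one_sub_pow_ne_zero hi) hu' hv' M'
  rw [map_pow] at hB
  have hρF : φ ρ = (-(φ q)) ^ ((1 - (n : ℤ)) / 2) * qInt n (φ q) := by
    have hb : φ b = (φ q)⁻¹ := by
      apply eq_inv_of_mul_eq_one_right
      rw [← map_mul, hqb, map_one]
    have hexp : (1 - (n : ℤ)) / 2 = -(c : ℤ) := by rw [hc]; push_cast; omega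
    rw [hρdef, map_mul, map_pow, map_neg, hb, map_sum, hexp, zpow_neg, zpow_natCast, ← inv_pow,
      inv_neg, qInt]
    simp
  refine ⟨(∑ k ∈ Finset.range (M + 1), weight q k * (u k ^ 2 * v k)) -
    ρ * ∑ k ∈ Finset.range (M' + 1), weight (q ^ n) k * (u' k ^ 2 * v' k), ?_, ?_, ?_⟩
  · rw [hA, hB, ← hρF, ← map_mul, ← map_sub]
  · exact hq.dvd_sub_sum_weight hdodd hd1 hn0 hu hu' (hq.isRatioSeq hv)
      (hq'.isRatioSeq hv') hρ (h.dvd_left hd) (h.dvd_right hr hn0 hd)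
  · rintro j hj rfl
    exact hq.pow_three_dvd_sub_sum_weight hdodd hd1 hc hu hu' (hq.isRatioSeq hv)
      (hq'.isRatioSeq hv') hρ (h.dvd_left hd) (h.dvd_right hr hn0 hd) hρ'
      (h.mul_add_le hr hc) (h.le_card hj ⟨c, hc⟩)

theorem congrMod (h : IsTruncationPair n r M M') (hn : 1 < n) (hodd : Odd n) (hr : 1 ≤ r) :
    CongrMod (modulus n r) (truncatedSum (RatFunc.X : RatFunc ℤ) M)
      ((-(RatFunc.X : RatFunc ℤ)) ^ ((1 - (n : ℤ)) / 2) * qInt n (RatFunc.X : RatFunc ℤ) *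
        truncatedSum ((RatFunc.X : RatFunc ℤ) ^ n) M') := by
  set F := truncatedSum (RatFunc.X : RatFunc ℤ) M -
    ((-(RatFunc.X : RatFunc ℤ)) ^ ((1 - (n : ℤ)) / 2) * qInt n (RatFunc.X : RatFunc ℤ) *
        truncatedSum ((RatFunc.X : RatFunc ℤ) ^ n) M') with hF
  obtain ⟨N, D, hND, hF'⟩ := IsFractionRing.exists_reduced_fraction ℤ[X] F
  have hD0 : (D : ℤ[X]) ≠ 0 := nonZeroDivisors.ne_zero D.2
  rw [IsFractionRing.mk'_eq_div] at hF'
  refine ⟨N, D, hD0, hND, hF'.symm, ?_⟩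
  have local_dvd : ∀ d, d ∣ n ^ r → 1 < d → cyclotomic d ℤ ∣ N ∧
      (∀ j ∈ Finset.Icc 1 r, d = n ^ j → cyclotomic d ℤ ^ 3 ∣ N) := by
    intro d hd hd1
    have hd0 : 0 < d := by omega
    have hζ := Complex.isPrimitiveRoot_exp d hd0.ne'
    obtain ⟨s, hs, h1, h3⟩ := h.exists_eq_sub hodd hr (φ := (regularAt _).subtype)
      Subtype.val_injective (isNearRoot_polyAt hd0 hζ) hd hd1
    rw [Subring.coe_subtype, coe_polyAt, RatFunc.algebraMap_X, ← hF, ← hF'] at hs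
    exact ⟨by simpa only [pow_one] using
        cyclotomic_pow_dvd_num (e := 1) hd0 hζ hD0 (by simpa only [pow_one] using h1) hs,
      fun j hj hdj => cyclotomic_pow_dvd_num hd0 hζ hD0 (h3 j hj hdj) hs⟩
  refine modulus_dvd hn (fun d hd hd1 => (local_dvd d hd hd1).1) fun j hj => ?_
  have hj' := Finset.mem_Icc.1 hj
  exact (local_dvd (n ^ j) (pow_dvd_pow n hj'.2) (Nat.one_lt_pow (by omega) hn)).2 j hj rfl

end IsTruncationPair

end QDwork

end

theorem theorem2 (n r : ℕ) (hn : 1 < n) (hodd : Odd n) (hr : 1 ≤ r) :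
    QDwork.CongrMod (QDwork.modulus n r)
      (QDwork.truncatedSum (RatFunc.X : RatFunc ℤ) ((n ^ r - 1) / 2))
      ((-(RatFunc.X : RatFunc ℤ)) ^ ((1 - (n : ℤ)) / 2) * QDwork.qInt n (RatFunc.X : RatFunc ℤ) *
        QDwork.truncatedSum ((RatFunc.X : RatFunc ℤ) ^ n) ((n ^ (r - 1) - 1) / 2)) ∧
    QDwork.CongrMod (QDwork.modulus n r)
      (QDwork.truncatedSum (RatFunc.X : RatFunc ℤ) (n ^ r - 1))
      ((-(RatFunc.X : RatFunc ℤ)) ^ ((1 - (n : ℤ)) / 2) * QDwork.qInt n (RatFunc.X : RatFunc ℤ) *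
        QDwork.truncatedSum ((RatFunc.X : RatFunc ℤ) ^ n) (n ^ (r - 1) - 1)) := by
  have h1 := Nat.div_add_mod (n ^ r) 2
  have h2 := Nat.div_add_mod (n ^ (r - 1)) 2
  have h3 := Nat.odd_iff.1 (hodd.pow (n := r))
  have h4 := Nat.odd_iff.1 (hodd.pow (n := r - 1))
  exact ⟨QDwork.IsTruncationPair.congrMod (Or.inl ⟨by omega, by omega⟩) hn hodd hr,
    QDwork.IsTruncationPair.congrMod (Or.inr ⟨by omega, by omega⟩) hn hodd hr⟩
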